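/- Let $X$ be a smooth manifold without boundary, of finite dimension. For a Riemannian metric $g$ on $X$ let $\nabla_g$ be its Levi-Civita connection, and for a symmetric $2$-tensor $v$ let $v^*_g := g^{-1}v$ be the endomorphism field of $T_X$ with $g(v^*_g\xi,\eta)=v(\xi,\eta)$. Put $$\mathbb F_g := \{\, v\in C^\infty(X,S^2T_X^*) \;:\; (\nabla_{g,\xi}v^*_g)\eta-(\nabla_{g,\eta}v^*_g)\xi=0 \ \text{ for all } \xi,\eta \,\},$$ that is, the covariant exterior derivative of the $T_X$-valued $1$-form $v^*_g$ vanishes. A pair $(J,g)$ is called a Kähler structure if $g$ is a smooth Riemannian metric on $X$, $J$ is a smooth endomorphism field of $T_X$ with $J^2=-\mathrm{Id}$, $g(J\xi,J\eta)=g(\xi,\eta)$ for all $\xi,\eta$, and $\nabla_g J=0$. Let $(g_t)_{t\ge 0}$ be a smooth family of Riemannian metrics on $X$ (smooth jointly in $(t,x)\in[0,\infty)\times X$) such that $\dot g_t\in\mathbb F_{g_t}$ for all $t\ge 0$, and let $(J_t)_{t\ge 0}$ be a family of endomorphism fields of $T_X$ which at every point of $X$ solves the ordinary differential equation $$2\dot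 J_t = J_t\,\dot g_t^*-\dot g_t^*\,J_t,\qquad t\ge 0,\qquad \dot g_t^*:=g_t^{-1}\dot g_t,$$ with $(J_0,g_0)$ a Kähler structure. Then $(J_t,g_t)_{t\ge 0}$ is a smooth family of Kähler structures: $(J_t)_{t\ge0}$ is smooth jointly in $(t,x)\in[0,\infty)\times X$, and $(J_t,g_t)$ is a Kähler structure for every $t\ge 0$. -/

import Mathlib

open Set Bundle
open scoped Manifold ContDiff

noncomputable section

namespace KahlerVariation

variable {E : Type*} [NormedAddCommGroup E] [NormedSpace ℝ E]
  {X : Type*} [TopologicalSpace X] [ChartedSpace E X]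

variable (E) in
/-- Fields of bilinear forms on the tangent spaces of `X`, that is, sections of
`T*X ⊗ T*X` (no smoothness required). A form is also read as a map `T X → T*X`. -/
abbrev FormField (X : Type*) [TopologicalSpace X] [ChartedSpace E X] :=
  (x : X) → TangentSpace 𝓘(ℝ, E) x →L[ℝ] TangentSpace 𝓘(ℝ, E) x →L[ℝ] ℝ

variable (E) in
/-- Fields of endomorphisms of the tangent spaces of `X` (no smoothness required). -/
abbrev EndField (X : Type*) [TopologicalSpace X] [ChartedSpace E X] :=
  (x : X) → TangentSpace 𝓘(ℝ, E) x →L[ℝ] TangentSpace 𝓘(ℝ, E) x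

variable (E) in
/-- Smooth Riemannian metrics on `X`. -/
abbrev Metric (X : Type*) [TopologicalSpace X] [ChartedSpace E X] [IsManifold 𝓘(ℝ, E) ∞ X] :=
  ContMDiffRiemannianMetric 𝓘(ℝ, E) ∞ E (fun x : X => TangentSpace 𝓘(ℝ, E) x)

/-! ### Smoothness of sections and of families of sections -/

section Smooth

variable [IsManifold 𝓘(ℝ, E) ∞ X]

/-- `v` is a smooth section of `T*X ⊗ T*X`. -/
def FormField.IsSmooth (v : FormField E X) : Prop :=
  ContMDiff 𝓘(ℝ, E) (𝓘(ℝ, E).prod 𝓘(ℝ, E →L[ℝ] E →L[ℝ] ℝ)) ∞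
    (fun x : X => TotalSpace.mk' (E →L[ℝ] E →L[ℝ] ℝ)
      (E := fun x : X => TangentSpace 𝓘(ℝ, E) x →L[ℝ] TangentSpace 𝓘(ℝ, E) x →L[ℝ] ℝ) x (v x))

/-- `A` is a smooth section of `End(TX)`. -/
def EndField.IsSmooth (A : EndField E X) : Prop :=
  ContMDiff 𝓘(ℝ, E) (𝓘(ℝ, E).prod 𝓘(ℝ, E →L[ℝ] E)) ∞
    (fun x : X => TotalSpace.mk' (E →L[ℝ] E)
      (E := fun x : X => TangentSpace 𝓘(ℝ, E) x →L[ℝ] TangentSpace 𝓘(ℝ, E) x) x (A x))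

/-- `(v t)_{t ≥ 0}` is a smooth family: smooth jointly in `(t, x) ∈ [0, ∞) × X`. -/
def FormField.IsSmoothFamily (v : ℝ → FormField E X) : Prop :=
  ContMDiffOn (𝓘(ℝ, ℝ).prod 𝓘(ℝ, E)) (𝓘(ℝ, E).prod 𝓘(ℝ, E →L[ℝ] E →L[ℝ] ℝ)) ∞
    (fun p : ℝ × X => TotalSpace.mk' (E →L[ℝ] E →L[ℝ] ℝ)
      (E := fun x : X => TangentSpace 𝓘(ℝ, E) x →L[ℝ] TangentSpace 𝓘(ℝ, E) x →L[ℝ] ℝ)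
      p.2 (v p.1 p.2)) (Ici 0 ×ˢ univ)

/-- `(A t)_{t ≥ 0}` is a smooth family: smooth jointly in `(t, x) ∈ [0, ∞) × X`. -/
def EndField.IsSmoothFamily (A : ℝ → EndField E X) : Prop :=
  ContMDiffOn (𝓘(ℝ, ℝ).prod 𝓘(ℝ, E)) (𝓘(ℝ, E).prod 𝓘(ℝ, E →L[ℝ] E)) ∞
    (fun p : ℝ × X => TotalSpace.mk' (E →L[ℝ] E)
      (E := fun x : X => TangentSpace 𝓘(ℝ, E) x →L[ℝ] TangentSpace 𝓘(ℝ, E) x)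
      p.2 (A p.1 p.2)) (Ici 0 ×ˢ univ)

end Smooth

/-! ### Tensors in local coordinates

The coordinates are those of the preferred chart `φ = extChartAt 𝓘(ℝ, E) x` at a point `x`; the
expressions below are meaningful at points `y ∈ E` of the target of `φ`, an open set. -/

/-- The coordinate frame `D(φ⁻¹)(y) : E → T_{φ⁻¹ y} X`. -/
def frame (x : X) (y : E) :
    E →L[ℝ] TangentSpace 𝓘(ℝ, E) ((extChartAt 𝓘(ℝ, E) x).symm y) :=
  mfderiv 𝓘(ℝ, E) 𝓘(ℝ, E) (extChartAt 𝓘(ℝ, E) x).symm y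

/-- The dual coframe `Dφ(φ⁻¹ y) : T_{φ⁻¹ y} X → E`, inverse to `frame x y`. -/
def coframe (x : X) (y : E) :
    TangentSpace 𝓘(ℝ, E) ((extChartAt 𝓘(ℝ, E) x).symm y) →L[ℝ] E :=
  mfderiv 𝓘(ℝ, E) 𝓘(ℝ, E) (extChartAt 𝓘(ℝ, E) x) ((extChartAt 𝓘(ℝ, E) x).symm y)

/-- Coordinate expression of a field of bilinear forms in the chart at `x`. -/
def FormField.inChart (v : FormField E X) (x : X) (y : E) : E →L[ℝ] E →L[ℝ] ℝ :=
  let b : E →L[ℝ] E →L[ℝ] ℝ := v ((extChartAt 𝓘(ℝ, E) x).symm y)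
  let f : E →L[ℝ] E := frame x y
  b.bilinearComp f f

/-- Coordinate expression of a field of endomorphisms in the chart at `x`. -/
def EndField.inChart (A : EndField E X) (x : X) (y : E) : E →L[ℝ] E :=
  coframe x y ∘L A ((extChartAt 𝓘(ℝ, E) x).symm y) ∘L frame x y

/-! ### Levi-Civita connection and Kähler structures -/

section Geometry

variable [IsManifold 𝓘(ℝ, E) ∞ X]

/-- For `G : E → (E →L E →L ℝ)` the matrix of a metric in coordinates, the Christoffel term
`Γ(u, v)` of its Levi-Civita connection at `y`, that is, the vector with
`2 G(Γ(u, v), w) = (D_u G)(v, w) + (D_v G)(u, w) - (D_w G)(u, v)` for all `w`.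
The inverse is that of `G y` as a map `E → E*`. -/
def christoffel (G : E → E →L[ℝ] E →L[ℝ] ℝ) (y u v : E) : E :=
  (1 / 2 : ℝ) • (G y).inverse
    (fderiv ℝ G y u v + fderiv ℝ G y v u - ((fderiv ℝ G y).flip u).flip v)

/-- The covariant derivative `∇_g A (ξ, η) = (∇_{g,ξ} A) η` at `x` of a field of endomorphisms
`A`, for the Levi-Civita connection of `g`, by its expression
`(D_ξ A) η + Γ(ξ, A η) - A Γ(ξ, η)` in the chart at `x`.
(By definition `TangentSpace 𝓘(ℝ, E) x` is `E`, a vector being identified with its coordinates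
in the preferred chart at `x`.) -/
def covDeriv (g : Metric E X) (A : EndField E X) (x : X) (ξ η : TangentSpace 𝓘(ℝ, E) x) :
    TangentSpace 𝓘(ℝ, E) x :=
  let y : E := extChartAt 𝓘(ℝ, E) x x
  let G : E → E →L[ℝ] E →L[ℝ] ℝ := FormField.inChart g.inner x
  let a : E → E →L[ℝ] E := A.inChart x
  (fderiv ℝ a y ξ η + christoffel G y ξ (a y η) - a y (christoffel G y ξ η) : E)

/-- The covariant exterior derivative `∇_{TX,g} A` of `A`, as a `TX`-valued `1`-form. -/
def covExtDeriv (g : Metric E X) (A : EndField E X) (x : X) (ξ η : TangentSpace 𝓘(ℝ, E) x) :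
    TangentSpace 𝓘(ℝ, E) x :=
  covDeriv g A x ξ η - covDeriv g A x η ξ

/-- The field of endomorphisms `v*_g = g⁻¹ v`, so that `g(v*_g ξ, η) = v(ξ, η)`. -/
def sharp (g : Metric E X) (v : FormField E X) : EndField E X :=
  fun x => (g.inner x).inverse ∘L v x

/-- The space `𝔽_g` of smooth symmetric `2`-tensors `v` with `∇_{TX,g} v*_g = 0`. -/
def spaceF (g : Metric E X) : Set (FormField E X) :=
  {v | v.IsSmooth ∧ (∀ x ξ η, v x ξ η = v x η ξ) ∧
    ∀ x ξ η, covExtDeriv g (sharp g v) x ξ η = 0}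

/-- `(J, g)` is a Kähler structure: `J` is a smooth almost complex structure, `g` is
`J`-invariant and `∇_g J = 0`. -/
structure IsKahler (J : EndField E X) (g : Metric E X) : Prop where
  smooth : J.IsSmooth
  sq : ∀ x ξ, J x (J x ξ) = -ξ
  invariant : ∀ x ξ η, g.inner x (J x ξ) (J x η) = g.inner x ξ η
  parallel : ∀ x ξ η, covDeriv g J x ξ η = 0

/-- The time derivative `ġ_t` of a family `(g_t)_{t ≥ 0}` (one-sided at `t = 0`). -/
def metricDeriv (g : ℝ → Metric E X) (t : ℝ) : FormField E X :=
  fun x => derivWithin (F := E →L[ℝ] E →L[ℝ] ℝ) (fun s => (g s).inner x) (Ici 0) t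

/-- The family `(J_t)_{t ≥ 0}` of fields of endomorphisms solves, at every point of `X`, the
equation `2 J̇_t = J_t ġ_t* - ġ_t* J_t` where `ġ_t* = g_t⁻¹ ġ_t` (one-sided derivative
at `t = 0`). -/
def SolvesODE (J : ℝ → EndField E X) (g : ℝ → Metric E X) : Prop :=
  ∀ t : ℝ, 0 ≤ t → ∀ x : X,
    HasDerivWithinAt (F := E →L[ℝ] E) (fun s => J s x)
      ((1 / 2 : ℝ) • (J t x ∘L sharp (g t) (metricDeriv g t) x
        - sharp (g t) (metricDeriv g t) x ∘L J t x)) (Ici 0) t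

end Geometry

end KahlerVariation

end

/-! Write S = g⁻¹ġ, so that ġ = g(S·,·) with S self-adjoint for g, and the equation for J is J̇ =
½[J, S]. The bracket with S is a derivation, so every obstruction to being Kähler satisfies a
homogeneous linear equation with coefficient S. It vanishes at t = 0, hence for all t by Grönwall
(`eq_zero_of_norm_deriv_le`).

The obstructions are J² + 1, which evolves by ½[·, S]; the form H(u, v) = g(Ju, v) + g(u, Jv), with
Ḣ = ½(H(S·,·) + H(·,S·)); and ∇_ξ J. Invariance of g follows from H = 0 together with J² = -1.

For ∇_ξ J the closedness of S is essential. Since ġ is symmetric, g((∇_a S)b, c) is symmetric in b,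
c; closedness adds symmetry in a, b. The tensor is then totally symmetric, and Koszul's formula
reduces to Γ̇_ξ = ½∇_ξ S (`hasDerivWithinAt_christoffelMap`). The resulting term ½[∇_ξ S, J] in the
derivative of ∇_ξ J cancels the term ½[J, ∇_ξ S] coming from J̇, which leaves ½[∇_ξ J, S]
(`chartCovDeriv_eq_zero_of_ode`).

Joint smoothness of J is smooth dependence of a linear equation on parameters
(`contDiffOn_of_bilinear_ode`): the solution is (1 - K)⁻¹ applied to the initial value, where K is a
Volterra operator depending smoothly on the parameters and inversion is smooth on units of a Banach
algebra. -/

set_option maxSynthPendingDepth 3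

noncomputable section

namespace KahlerVariation

universe u

open scoped Topology

/-! ### Curves depending smoothly on a parameter, as elements of a space of curves -/

section Curves

variable {P V W : Type u} [NormedAddCommGroup P] [NormedSpace ℝ P]
  [NormedAddCommGroup V] [NormedSpace ℝ V] [NormedAddCommGroup W] [NormedSpace ℝ W]

/-- Pointwise application of a bilinear map to a curve and a vector. -/
def curveApply (β : V →L[ℝ] P →L[ℝ] W) : C(unitInterval, V) →L[ℝ] P →L[ℝ] C(unitInterval, W) :=
  LinearMap.mkContinuous₂
    (LinearMap.mk₂ ℝ (fun (f : C(unitInterval, V)) (v : P) =>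
        (⟨fun s => β (f s) v, by fun_prop⟩ : C(unitInterval, W)))
      (fun f f' v => by ext; simp) (fun c f v => by ext; simp)
      (fun f v v' => by ext; simp) (fun c f v => by ext; simp)) ‖β‖
    (fun f v => by
      refine (ContinuousMap.norm_le _ (by positivity)).2 fun s => ?_
      refine (β.le_opNorm₂ (f s) v).trans ?_
      gcongr
      exact f.norm_coe_le_norm s)

@[simp]
lemma curveApply_apply (β : V →L[ℝ] P →L[ℝ] W) (f : C(unitInterval, V)) (v : P)
    (s : unitInterval) : curveApply β f v s = β (f s) v := rfl

omit [NormedSpace ℝ P] [NormedSpace ℝ W] in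
/-- A jointly continuous family of curves, as a map to the space of continuous curves. -/
lemma exists_continuousOn_curve {F : P × ℝ → W} {D : Set P}
    (hF : ContinuousOn F (D ×ˢ Icc 0 1)) :
    ∃ c : P → C(unitInterval, W), (∀ p ∈ D, ∀ s : unitInterval, c p s = F (p, s)) ∧
      ContinuousOn c D := by
  classical
  have hcurve : ∀ p ∈ D, Continuous fun s : unitInterval => F (p, s) := fun p hp =>
    hF.comp_continuous (by fun_prop) fun s => ⟨hp, s.2⟩
  set c : P → C(unitInterval, W) := fun p => if hp : p ∈ D then ⟨_, hcurve p hp⟩ else 0 with hc_def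
  have hc : ∀ p ∈ D, ∀ s : unitInterval, c p s = F (p, s) := fun p hp s => by simp [hc_def, hp]
  refine ⟨c, hc, ?_⟩
  rw [continuousOn_iff_continuous_domRestrict]
  refine ContinuousMap.continuous_of_continuous_uncurry _ ?_
  have h1 : Continuous fun q : D × unitInterval => F ((q.1 : P), (q.2 : ℝ)) :=
    hF.comp_continuous (by fun_prop) fun q => ⟨q.1.2, q.2.2⟩
  convert h1 using 2 with q
  exact hc q.1 q.1.2 q.2

/-- The remainder must be small uniformly in s. Continuity of c' in the sup norm gives one radius on
which β ∘ c' varies by less than ε for every s, and the mean value inequality on the convex set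
`ball p δ ∩ D` turns this into the remainder estimate. -/
lemma hasFDerivWithinAt_curve {F : P × ℝ → W} {D : Set P} (hD : Convex ℝ D)
    (β : V →L[ℝ] P →L[ℝ] W) {F' : P × ℝ → V}
    (hF : ∀ p ∈ D, ∀ s ∈ Icc (0 : ℝ) 1,
      HasFDerivWithinAt (fun q => F (q, s)) (β (F' (p, s))) D p)
    {c : P → C(unitInterval, W)} (hc : ∀ p ∈ D, ∀ s : unitInterval, c p s = F (p, s))
    {c' : P → C(unitInterval, V)} (hc' : ∀ p ∈ D, ∀ s : unitInterval, c' p s = F' (p, s))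
    (hcont : ContinuousOn c' D) {p : P} (hp : p ∈ D) :
    HasFDerivWithinAt c (curveApply β (c' p)) D p := by
  rw [hasFDerivWithinAt_iff_isLittleO, Asymptotics.isLittleO_iff]
  intro ε hε
  have hcont' : ContinuousWithinAt (fun q => ‖β‖ * ‖c' q - c' p‖) D p :=
    continuousWithinAt_const.mul ((hcont p hp).sub continuousWithinAt_const).norm
  have hev : ∀ᶠ q in 𝓝[D] p, ‖β‖ * ‖c' q - c' p‖ < ε :=
    hcont'.eventually_lt_const (by simpa using hε)
  obtain ⟨δ, hδ, hball⟩ := Metric.mem_nhdsWithin_iff.1 hev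
  have hmem : Metric.ball p δ ∩ D ∈ 𝓝[D] p :=
    Filter.inter_mem (mem_nhdsWithin_of_mem_nhds (Metric.ball_mem_nhds p hδ)) self_mem_nhdsWithin
  filter_upwards [hmem] with q hq
  refine (ContinuousMap.norm_le _ (by positivity)).2 fun s => ?_
  have hp' : p ∈ Metric.ball p δ ∩ D := ⟨Metric.mem_ball_self hδ, hp⟩
  have key := Convex.norm_image_sub_le_of_norm_hasFDerivWithin_le' (𝕜 := ℝ)
    (f := fun q => F (q, s)) (f' := fun q => β (F' (q, s))) (φ := β (F' (p, s))) (C := ε)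
    (s := Metric.ball p δ ∩ D) (x := p) (y := q)
    (fun r hr => (hF r hr.2 s s.2).mono inter_subset_right) ?_
    ((convex_ball p δ).inter hD) hp' hq
  · simpa [hc q hq.2, hc p hp, hc' p hp] using key
  · intro r hr
    rw [← hc' r hr.2, ← hc' p hp, ← map_sub, ← ContinuousMap.sub_apply]
    refine (β.le_opNorm _).trans (le_trans ?_ (hball hr).le)
    gcongr
    exact ContinuousMap.norm_coe_le_norm _ s

lemma contDiffOn_succ_of_hasFDerivWithinAt {D : Set P} (hD : UniqueDiffOn ℝ D)
    (β : V →L[ℝ] P →L[ℝ] W) {n : ℕ} {c' : P → V} (hc' : ContDiffOn ℝ n c' D) {c : P → W}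
    (hc : ∀ p ∈ D, HasFDerivWithinAt c (β (c' p)) D p) : ContDiffOn ℝ (n + 1) c D := by
  rw [contDiffOn_succ_iff_hasFDerivWithinAt_of_uniqueDiffOn hD]
  exact ⟨by simp, fun p => β (c' p), β.contDiff.comp_contDiffOn hc', hc⟩

lemma exists_contDiffOn_curve_succ {F : P × ℝ → W} {D : Set P} (hD : Convex ℝ D)
    (hD' : UniqueDiffOn ℝ D) (β : V →L[ℝ] P →L[ℝ] W) {F' : P × ℝ → V} (n : ℕ)
    (hF : ∀ p ∈ D, ∀ s ∈ Icc (0 : ℝ) 1,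
      HasFDerivWithinAt (fun q => F (q, s)) (β (F' (p, s))) D p)
    (hFc : ContinuousOn F (D ×ˢ Icc 0 1))
    (h : ∃ c' : P → C(unitInterval, V), (∀ p ∈ D, ∀ s : unitInterval, c' p s = F' (p, s)) ∧
      ContDiffOn ℝ n c' D) :
    ∃ c : P → C(unitInterval, W), (∀ p ∈ D, ∀ s : unitInterval, c p s = F (p, s)) ∧
      ContDiffOn ℝ (n + 1) c D := by
  obtain ⟨c, hc, -⟩ := exists_continuousOn_curve hFc
  obtain ⟨c', hc', hn⟩ := h
  refine ⟨c, hc, ?_⟩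
  exact contDiffOn_succ_of_hasFDerivWithinAt hD' (curveApply β) hn
    fun p hp => hasFDerivWithinAt_curve hD β hF hc hc' hn.continuousOn hp

/-- The target W is quantified inside the induction because the step applies the hypothesis to the
partial derivative in P, which takes values in `P →L[ℝ] W`. -/
lemma exists_contDiffOn_curve_nat {P : Type u} [NormedAddCommGroup P] [NormedSpace ℝ P]
    {D : Set P} (hD : Convex ℝ D) (hD' : UniqueDiffOn ℝ D) (n : ℕ) :
    ∀ {W : Type u} [NormedAddCommGroup W] [NormedSpace ℝ W] {F : P × ℝ → W}
      (_ : ContDiffOn ℝ n F (D ×ˢ Icc 0 1)),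
      ∃ c : P → C(unitInterval, W), (∀ p ∈ D, ∀ s : unitInterval, c p s = F (p, s)) ∧
        ContDiffOn ℝ n c D := by
  have hU : UniqueDiffOn ℝ (D ×ˢ Icc (0 : ℝ) 1) := hD'.prod (uniqueDiffOn_Icc zero_lt_one)
  induction n with
  | zero =>
    intro W _ _ F hF
    simp only [Nat.cast_zero, contDiffOn_zero] at *
    exact exists_continuousOn_curve hF
  | succ n ih =>
    intro W _ _ F hF
    rw [Nat.cast_succ] at *
    have hF'n : ContDiffOn ℝ n (fun z => (fderivWithin ℝ F (D ×ˢ Icc 0 1) z).comp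
        (ContinuousLinearMap.inl ℝ P ℝ)) (D ×ˢ Icc 0 1) :=
      (hF.fderivWithin hU le_rfl).clm_comp contDiffOn_const
    refine exists_contDiffOn_curve_succ hD hD' (ContinuousLinearMap.id ℝ (P →L[ℝ] W)) n ?_
      hF.continuousOn (ih hF'n)
    intro p hp s hs
    have h1 : HasFDerivWithinAt F (fderivWithin ℝ F (D ×ˢ Icc 0 1) (p, s)) (D ×ˢ Icc 0 1)
        (p, s) := (hF.differentiableOn (by simp) _ ⟨hp, hs⟩).hasFDerivWithinAt
    have hm : MapsTo (fun q => (q, s)) D (D ×ˢ Icc (0 : ℝ) 1) := fun q hq => ⟨hq, hs⟩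
    exact h1.comp p (hasFDerivAt_prodMk_left p s).hasFDerivWithinAt hm

/-- A jointly smooth family of curves is a smooth map to the space of continuous curves. -/
lemma exists_contDiffOn_curve {D : Set P} (hD : Convex ℝ D) (hD' : UniqueDiffOn ℝ D)
    {F : P × ℝ → W} (hF : ContDiffOn ℝ ∞ F (D ×ˢ Icc 0 1)) :
    ∃ c : P → C(unitInterval, W), (∀ p ∈ D, ∀ s : unitInterval, c p s = F (p, s)) ∧
      ContDiffOn ℝ ∞ c D := by
  -- One c serves all orders n: on D, the curves produced for each n have the same values as c.
  obtain ⟨c, hc, -⟩ := exists_continuousOn_curve hF.continuousOn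
  refine ⟨c, hc, contDiffOn_infty.2 fun n => ?_⟩
  obtain ⟨c', hc', hn⟩ := exists_contDiffOn_curve_nat hD hD' n (contDiffOn_infty.1 hF n)
  refine hn.congr fun p hp => ?_
  ext s
  rw [hc p hp, hc' p hp]

end Curves

/-! ### Volterra operators -/

section Inverse

variable {Z : Type u} [NormedAddCommGroup Z] [NormedSpace ℝ Z] [CompleteSpace Z]

/-- 1 - Kⁿ is the product of 1 - K and a geometric sum commuting with it, so K itself may have large
norm. -/
lemma isUnit_one_sub_of_norm_pow_lt_one {K : Z →L[ℝ] Z} {n : ℕ} (hn : ‖K ^ n‖ < 1) :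
    IsUnit (1 - K) := by
  have h1 : IsUnit (1 - K ^ n) := isUnit_one_sub_of_norm_lt_one hn
  rw [← mul_neg_geom_sum] at h1
  refine ((Commute.isUnit_mul_iff ?_).1 h1).1
  exact (mul_neg_geom_sum K n).trans (geom_sum_mul_neg K n).symm

/-- Since b = (1 - K(c))⁻¹ z and inversion is smooth at units, b inherits the smoothness of c and z
without any prior regularity. -/
lemma contDiffOn_of_one_sub_apply_eq {P Y : Type u} [NormedAddCommGroup P] [NormedSpace ℝ P]
    [NormedAddCommGroup Y] [NormedSpace ℝ Y] (K : Y →L[ℝ] Z →L[ℝ] Z)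
    {D : Set P} {c : P → Y} (hc : ContDiffOn ℝ ∞ c D)
    (hu : ∀ p ∈ D, IsUnit (1 - K (c p))) {b z : P → Z} (hz : ContDiffOn ℝ ∞ z D)
    (hb : ∀ p ∈ D, b p - K (c p) (b p) = z p) : ContDiffOn ℝ ∞ b D := by
  have h1 : ContDiffOn ℝ ∞ (fun p => Ring.inverse (1 - K (c p)) (z p)) D := by
    refine ContDiffOn.clm_apply (fun p hp => ?_) hz
    obtain ⟨v, hv⟩ := hu p hp
    have h2 := contDiffAt_ringInverse ℝ (n := ∞) v
    rw [hv] at h2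
    exact h2.comp_contDiffWithinAt p (contDiffWithinAt_const.sub (K.contDiff.comp_contDiffOn hc p hp))
  refine h1.congr fun p hp => ?_
  have h3 : (1 - K (c p)) (b p) = z p := hb p hp
  rw [← h3, ← mul_apply_eq_comp, Ring.inverse_mul_cancel _ (hu p hp)]
  rfl

end Inverse

section Volterra

variable {V F : Type u} [NormedAddCommGroup V] [NormedSpace ℝ V]
  [NormedAddCommGroup F] [NormedSpace ℝ F]

/-- The primitive vanishing at `0` of a continuous curve. -/
def primitive (F : Type u) [NormedAddCommGroup F] [NormedSpace ℝ F] :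
    C(unitInterval, F) →L[ℝ] C(unitInterval, F) :=
  LinearMap.mkContinuous
    { toFun := fun f => ⟨fun t => ∫ s in (0 : ℝ)..t, f (projIcc 0 1 zero_le_one s), by
        refine (intervalIntegral.continuous_primitive (fun a b => ?_) 0).comp
          continuous_subtype_val
        exact Continuous.intervalIntegrable (by fun_prop) _ _⟩
      map_add' := fun f f' => by
        ext t
        exact intervalIntegral.integral_add
          (Continuous.intervalIntegrable (by fun_prop) _ _)
          (Continuous.intervalIntegrable (by fun_prop) _ _)
      map_smul' := fun c f => by
        ext t
        exact intervalIntegral.integral_smul c _ } 1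
    (fun f => by
      refine (ContinuousMap.norm_le _ (by positivity)).2 fun t => ?_
      refine (intervalIntegral.norm_integral_le_of_norm_le_const (C := ‖f‖)
        fun s _ => f.norm_coe_le_norm _).trans ?_
      rw [one_mul, sub_zero, abs_of_nonneg t.2.1]
      exact mul_le_of_le_one_right (norm_nonneg f) t.2.2)

/-- Pointwise application of a bilinear map to two curves. -/
def curveMul (β : V →L[ℝ] F →L[ℝ] F) :
    C(unitInterval, V) →L[ℝ] C(unitInterval, F) →L[ℝ] C(unitInterval, F) :=
  LinearMap.mkContinuous₂
    (LinearMap.mk₂ ℝ (fun (A : C(unitInterval, V)) (f : C(unitInterval, F)) =>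
        (⟨fun s => β (A s) (f s), by fun_prop⟩ : C(unitInterval, F)))
      (fun f f' v => by ext; simp) (fun c f v => by ext; simp)
      (fun f v v' => by ext; simp) (fun c f v => by ext; simp)) ‖β‖
    (fun A f => by
      refine (ContinuousMap.norm_le _ (by positivity)).2 fun s => ?_
      refine (β.le_opNorm₂ (A s) (f s)).trans ?_
      gcongr
      · exact A.norm_coe_le_norm s
      · exact f.norm_coe_le_norm s)

/-- The Volterra operator `f ↦ ∫₀ᵗ A f` of a continuous curve `A` of operators, as a linear
function of `A`. -/
def volterra (β : V →L[ℝ] F →L[ℝ] F) :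
    C(unitInterval, V) →L[ℝ] C(unitInterval, F) →L[ℝ] C(unitInterval, F) :=
  (ContinuousLinearMap.compL ℝ _ _ _ (primitive F)).comp (curveMul β)

lemma volterra_apply (β : V →L[ℝ] F →L[ℝ] F) (A : C(unitInterval, V)) (f : C(unitInterval, F))
    (t : unitInterval) :
    volterra β A f t = ∫ s in (0 : ℝ)..t,
      β (A (projIcc 0 1 zero_le_one s)) (f (projIcc 0 1 zero_le_one s)) := rfl

/-- The bound keeps its dependence on t: integrating sⁿ at each iteration is what produces the
factorial. -/
lemma norm_volterra_pow_apply_le (β : V →L[ℝ] F →L[ℝ] F) (A : C(unitInterval, V)) (n : ℕ)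
    (f : C(unitInterval, F)) (t : unitInterval) :
    ‖(volterra β A ^ n) f t‖ ≤ (‖β‖ * ‖A‖) ^ n * ‖f‖ * (t : ℝ) ^ n / n.factorial := by
  induction n generalizing t with
  | zero => simpa using f.norm_coe_le_norm t
  | succ n ih =>
    rw [pow_succ', mul_apply_eq_comp, volterra_apply]
    have h1 : ∀ s ∈ Ioc (0 : ℝ) t,
        ‖β (A (projIcc 0 1 zero_le_one s))
          ((volterra β A ^ n) f (projIcc 0 1 zero_le_one s))‖ ≤
          (‖β‖ * ‖A‖) ^ (n + 1) * ‖f‖ / n.factorial * s ^ n := by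
      intro s hs
      have hs' : s ∈ Icc (0 : ℝ) 1 := ⟨hs.1.le, hs.2.trans t.2.2⟩
      rw [projIcc_of_mem zero_le_one hs']
      refine (β.le_opNorm₂ _ _).trans ((mul_le_mul
        (mul_le_mul_of_nonneg_left (A.norm_coe_le_norm _) (norm_nonneg β)) (ih _)
        (norm_nonneg _) (by positivity)).trans (le_of_eq ?_))
      simp only
      ring
    refine (intervalIntegral.norm_integral_le_of_norm_le t.2.1
      (MeasureTheory.ae_of_all _ h1)
      (Continuous.intervalIntegrable (by fun_prop) _ _)).trans (le_of_eq ?_)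
    rw [intervalIntegral.integral_const_mul, integral_pow, Nat.factorial_succ]
    push_cast
    have : (n.factorial : ℝ) ≠ 0 := by positivity
    field_simp
    simp

/-- On [0, 1] the n-th power has norm at most (‖β‖‖A‖)ⁿ/n!, which is eventually below 1. -/
lemma isUnit_one_sub_volterra [CompleteSpace F] (β : V →L[ℝ] F →L[ℝ] F)
    (A : C(unitInterval, V)) : IsUnit (1 - volterra β A) := by
  obtain ⟨n, hn⟩ := ((FloorSemiring.tendsto_pow_div_factorial_atTop (‖β‖ * ‖A‖)).eventually
    (gt_mem_nhds zero_lt_one)).exists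
  refine isUnit_one_sub_of_norm_pow_lt_one (n := n) (lt_of_le_of_lt ?_ hn)
  have h0 : 0 ≤ (‖β‖ * ‖A‖) ^ n / n.factorial := by positivity
  refine ContinuousLinearMap.opNorm_le_bound _ h0 fun f => ?_
  refine (ContinuousMap.norm_le _ (mul_nonneg h0 (norm_nonneg f))).2 fun t => ?_
  refine (norm_volterra_pow_apply_le β A n f t).trans ?_
  rw [div_mul_eq_mul_div]
  have h1 : 0 ≤ (‖β‖ * ‖A‖) ^ n * ‖f‖ :=
    mul_nonneg (pow_nonneg (mul_nonneg (norm_nonneg β) (norm_nonneg A)) n) (norm_nonneg f)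
  exact div_le_div_of_nonneg_right (mul_le_of_le_one_right h1 (pow_le_one₀ t.2.1 t.2.2))
    (Nat.cast_nonneg _)

end Volterra

/-! ### Linear differential equations depending on a parameter -/

section LinearODE

variable {E F : Type u} [NormedAddCommGroup E] [NormedSpace ℝ E]
  [NormedAddCommGroup F] [NormedSpace ℝ F]

lemma uniqueDiffOn_Ici_prod {B : Set E} (hB : IsOpen B) :
    UniqueDiffOn ℝ (Ici (0 : ℝ) ×ˢ B) :=
  (uniqueDiffOn_Ici 0).prod hB.uniqueDiffOn

lemma contDiffOn_of_bilinear_ode {V : Type u} [NormedAddCommGroup V] [NormedSpace ℝ V]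
    [CompleteSpace F] (β : V →L[ℝ] F →L[ℝ] F) {B : Set E} (hB : IsOpen B)
    (hBc : Convex ℝ B) {A : ℝ × E → V} (hA : ContDiffOn ℝ ∞ A (Ici 0 ×ˢ B))
    {w : ℝ × E → F} (hw : ∀ y ∈ B, ∀ t : ℝ, 0 ≤ t →
      HasDerivWithinAt (fun s => w (s, y)) (β (A (t, y)) (w (t, y))) (Ici 0) t)
    (hw0 : ContDiffOn ℝ ∞ (fun y => w (0, y)) B) :
    ContDiffOn ℝ ∞ w (Ici 0 ×ˢ B) := by
  classical
  set D : Set (ℝ × E) := Ici (0 : ℝ) ×ˢ B with hD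
  have hDc : Convex ℝ D := (convex_Ici 0).prod hBc
  have hDu : UniqueDiffOn ℝ D := uniqueDiffOn_Ici_prod hB
  -- Time is rescaled so that all solution curves live on [0, 1]: s ↦ w(sτ, y) solves the linear
  -- equation with coefficient R = τ A(sτ, y), and its value at s = 1 is w(τ, y). Smoothness in τ
  -- thus becomes smoothness in a parameter.
  set R : (ℝ × E) × ℝ → V := fun z => z.1.1 • A (z.2 * z.1.1, z.1.2) with hR
  have hRn : ContDiffOn ℝ ∞ R (D ×ˢ Icc 0 1) := by
    refine ContDiffOn.smul (f := fun z : (ℝ × E) × ℝ => z.1.1) (by fun_prop)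
      (hA.comp (g := A) (f := fun z : (ℝ × E) × ℝ => (z.2 * z.1.1, z.1.2)) (by fun_prop) ?_)
    rintro ⟨⟨τ, y⟩, s⟩ ⟨⟨hτ, hy⟩, hs⟩
    exact ⟨mul_nonneg hs.1 hτ, hy⟩
  obtain ⟨c, hc, hcn⟩ := exists_contDiffOn_curve hDc hDu hRn
  have hderiv : ∀ p ∈ D, ∀ s ∈ Icc (0 : ℝ) 1, HasDerivWithinAt (fun r => w (r * p.1, p.2))
      (β (R (p, s)) (w (s * p.1, p.2))) (Icc 0 1) s := by
    intro p hp s hs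
    have h1 := (hw p.2 hp.2 (s * p.1) (mul_nonneg hs.1 hp.1)).scomp s
      (((hasDerivAt_id s).mul_const p.1).hasDerivWithinAt (s := Icc 0 1))
      (fun r hr => mul_nonneg hr.1 hp.1)
    simpa [hR, Function.comp_def] using h1
  have hcont : ∀ p ∈ D, ContinuousOn (fun r => w (r * p.1, p.2)) (Icc 0 1) :=
    fun p hp s hs => (hderiv p hp s hs).continuousWithinAt
  set b : ℝ × E → C(unitInterval, F) := fun p => if hp : p ∈ D then
    ⟨fun s => w (s * p.1, p.2), continuousOn_iff_continuous_domRestrict.1 (hcont p hp)⟩ else 0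
    with hb_def
  have hb : ∀ p ∈ D, ∀ s : unitInterval, b p s = w (s * p.1, p.2) := fun p hp s => by
    simp only [hb_def, hp, dite_true]
    rfl
  have heq : ∀ p ∈ D, b p - volterra β (c p) (b p) =
      ContinuousLinearMap.const ℝ unitInterval (w (0, p.2)) := by
    intro p hp
    ext t
    have hi : ∫ s in (0 : ℝ)..t, β (R (p, s)) (w (s * p.1, p.2)) =
        w (t * p.1, p.2) - w (0 * p.1, p.2) := by
      refine intervalIntegral.integral_eq_sub_of_hasDeriv_right
        (f := fun r => w (r * p.1, p.2)) ?_ ?_ ?_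
      · rw [uIcc_of_le t.2.1]
        exact (hcont p hp).mono (Icc_subset_Icc_right t.2.2)
      · intro s hs
        rw [min_eq_left t.2.1, max_eq_right t.2.1] at hs
        have hs1 : s < 1 := hs.2.trans_le t.2.2
        exact ((hderiv p hp s ⟨hs.1.le, hs1.le⟩).hasDerivAt
          (Icc_mem_nhds hs.1 hs1)).hasDerivWithinAt
      · refine ContinuousOn.intervalIntegrable_of_Icc t.2.1 ?_
        have hRc : ContinuousOn (fun s : ℝ => β (R (p, s))) (Icc 0 1) :=
          β.continuous.comp_continuousOn
            (hRn.continuousOn.comp (by fun_prop) fun s hs => ⟨hp, hs⟩)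
        exact (hRc.clm_apply (hcont p hp)).mono (Icc_subset_Icc_right t.2.2)
    have hi' : volterra β (c p) (b p) t =
        ∫ s in (0 : ℝ)..t, β (R (p, s)) (w (s * p.1, p.2)) := by
      rw [volterra_apply]
      refine intervalIntegral.integral_congr fun s hs => ?_
      rw [uIcc_of_le t.2.1] at hs
      have hs' : s ∈ Icc (0 : ℝ) 1 := ⟨hs.1, hs.2.trans t.2.2⟩
      simp only [projIcc_of_mem zero_le_one hs', hc p hp, hb p hp]
    rw [ContinuousMap.sub_apply, hi', hi, hb p hp, zero_mul, sub_sub_cancel]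
    rfl
  have hbn : ContDiffOn ℝ ∞ b D :=
    contDiffOn_of_one_sub_apply_eq (volterra β) hcn
      (fun p _ => isUnit_one_sub_volterra β (c p))
      (z := fun p => ContinuousLinearMap.const ℝ unitInterval (w (0, p.2)))
      ((ContinuousLinearMap.const ℝ unitInterval).contDiff.comp_contDiffOn
        (hw0.comp contDiffOn_snd fun p hp => hp.2)) heq
  refine ((ContinuousMap.evalCLM ℝ (1 : unitInterval)).contDiff.comp_contDiffOn hbn).congr
    fun p hp => ?_
  have h1 : b p 1 = w ((1 : ℝ) * p.1, p.2) := hb p hp 1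
  rw [one_mul] at h1
  exact h1.symm

/-- A curve which vanishes at time `0` and whose derivative is bounded by a multiple of the curve
vanishes identically. -/
theorem eq_zero_of_norm_deriv_le {k : ℝ → ℝ} (hk : ContinuousOn k (Ici 0)) {w w' : ℝ → F}
    (hw : ∀ t : ℝ, 0 ≤ t → HasDerivWithinAt w (w' t) (Ici 0) t)
    (hw' : ∀ t : ℝ, 0 ≤ t → ‖w' t‖ ≤ k t * ‖w t‖) (hw0 : w 0 = 0)
    {t : ℝ} (ht : 0 ≤ t) : w t = 0 := by
  obtain ⟨K, hK⟩ := (isCompact_Icc (a := (0 : ℝ)) (b := t)).exists_bound_of_continuousOn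
    (hk.mono Icc_subset_Ici_self)
  have h := norm_le_gronwallBound_of_norm_deriv_right_le (f := w) (f' := w')
    (δ := 0) (K := K) (ε := 0) (a := 0) (b := t)
    (fun s hs => (hw s hs.1).continuousWithinAt.mono Icc_subset_Ici_self)
    (fun s hs => (hw s hs.1).mono (Ici_subset_Ici.2 hs.1)) (by simp [hw0])
    (fun s hs => by
      rw [add_zero]
      exact (hw' s hs.1).trans (mul_le_mul_of_nonneg_right
        ((Real.le_norm_self _).trans (hK s ⟨hs.1, hs.2.le⟩)) (norm_nonneg _)))
    t (right_mem_Icc.2 ht)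
  rw [gronwallBound_ε0_δ0] at h
  exact norm_le_zero_iff.1 h

end LinearODE

end KahlerVariation

end

noncomputable section

namespace KahlerVariation

universe u

open scoped Topology

variable {E W : Type u} [NormedAddCommGroup E] [NormedSpace ℝ E]
  [NormedAddCommGroup W] [NormedSpace ℝ W]

/-! ### Families of functions depending smoothly on time -/

section TimeDerivative

-- Second derivatives within a set are symmetric at points in the closure of its interior; this
-- takes care of the boundary time t = 0.
omit [NormedSpace ℝ E] in
lemma subset_closure_interior_Ici_prod {U : Set E} (hU : IsOpen U) :
    Ici (0 : ℝ) ×ˢ U ⊆ closure (interior (Ici (0 : ℝ) ×ˢ U)) := by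
  rw [interior_prod_eq, closure_prod_eq, interior_Ici, closure_Ioi, hU.interior_eq]
  exact prod_mono_right subset_closure

variable {U : Set E} {f f' : ℝ × E → W}

lemma hasDerivWithinAt_time (hf : ContDiffOn ℝ ∞ f (Ici 0 ×ˢ U)) {t : ℝ}
    (ht : 0 ≤ t) {y : E} (hy : y ∈ U) :
    HasDerivWithinAt (fun s => f (s, y)) (fderivWithin ℝ f (Ici 0 ×ˢ U) (t, y) (1, 0))
      (Ici 0) t := by
  have h1 : HasFDerivWithinAt f (fderivWithin ℝ f (Ici 0 ×ˢ U) (t, y)) (Ici 0 ×ˢ U) (t, y) :=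
    (hf.differentiableOn (by simp) (t, y) ⟨ht, hy⟩).hasFDerivWithinAt
  have hm : MapsTo (fun s => (s, y)) (Ici (0 : ℝ)) (Ici (0 : ℝ) ×ˢ U) := fun s hs => ⟨hs, hy⟩
  exact h1.comp_hasDerivWithinAt t
    ((hasDerivAt_id t).hasDerivWithinAt.prodMk (hasDerivWithinAt_const t (Ici 0) y)) hm

lemma hasFDerivAt_space (hU : IsOpen U) (hf : ContDiffOn ℝ ∞ f (Ici 0 ×ˢ U)) {t : ℝ}
    (ht : 0 ≤ t) {y : E} (hy : y ∈ U) :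
    HasFDerivAt (fun z => f (t, z))
      ((fderivWithin ℝ f (Ici 0 ×ˢ U) (t, y)).comp (ContinuousLinearMap.inr ℝ ℝ E)) y := by
  have h1 : HasFDerivWithinAt f (fderivWithin ℝ f (Ici 0 ×ˢ U) (t, y)) (Ici 0 ×ˢ U) (t, y) :=
    (hf.differentiableOn (by simp) (t, y) ⟨ht, hy⟩).hasFDerivWithinAt
  have hm : MapsTo (fun z => (t, z)) U (Ici (0 : ℝ) ×ˢ U) := fun z hz => ⟨ht, hz⟩
  exact (h1.comp y (hasFDerivAt_prodMk_right t y).hasFDerivWithinAt hm).hasFDerivAt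
    (hU.mem_nhds hy)

lemma fderivWithin_apply_eq_of_hasDerivWithinAt
    (hf : ContDiffOn ℝ ∞ f (Ici 0 ×ˢ U))
    (hf' : ∀ y ∈ U, ∀ t : ℝ, 0 ≤ t →
      HasDerivWithinAt (fun s => f (s, y)) (f' (t, y)) (Ici 0) t) {p : ℝ × E}
    (hp : p ∈ Ici (0 : ℝ) ×ˢ U) : f' p = fderivWithin ℝ f (Ici 0 ×ˢ U) p (1, 0) :=
  (uniqueDiffOn_Ici 0 p.1 hp.1).eq_deriv _ (hf' p.2 hp.2 p.1 hp.1)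
    (hasDerivWithinAt_time hf hp.1 hp.2)

lemma contDiffOn_time_deriv (hU : IsOpen U) (hf : ContDiffOn ℝ ∞ f (Ici 0 ×ˢ U))
    (hf' : ∀ y ∈ U, ∀ t : ℝ, 0 ≤ t →
      HasDerivWithinAt (fun s => f (s, y)) (f' (t, y)) (Ici 0) t) :
    ContDiffOn ℝ ∞ f' (Ici 0 ×ˢ U) :=
  ((hf.fderivWithin (uniqueDiffOn_Ici_prod hU) (m := ∞) (by simp)).clm_apply
    contDiffOn_const).congr
    fun _ hp => fderivWithin_apply_eq_of_hasDerivWithinAt hf hf' hp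

/-- Time derivatives and space derivatives commute. -/
lemma hasDerivWithinAt_fderiv (hU : IsOpen U) (hf : ContDiffOn ℝ ∞ f (Ici 0 ×ˢ U))
    (hf' : ∀ y ∈ U, ∀ t : ℝ, 0 ≤ t →
      HasDerivWithinAt (fun s => f (s, y)) (f' (t, y)) (Ici 0) t)
    {t : ℝ} (ht : 0 ≤ t) {y : E} (hy : y ∈ U) :
    HasDerivWithinAt (fun s => fderiv ℝ (fun z => f (s, z)) y)
      (fderiv ℝ (fun z => f' (t, z)) y) (Ici 0) t := by
  set S : Set (ℝ × E) := Ici (0 : ℝ) ×ˢ U with hS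
  have hSu : UniqueDiffOn ℝ S := uniqueDiffOn_Ici_prod hU
  have hp : (t, y) ∈ S := ⟨ht, hy⟩
  have hD : ContDiffOn ℝ ∞ (fderivWithin ℝ f S) S := hf.fderivWithin hSu (by simp)
  set D2 := fderivWithin ℝ (fderivWithin ℝ f S) S (t, y) with hD2
  have hsymm : ∀ v w, D2 v w = D2 w v :=
    ((contDiffOn_infty.1 hf 2) (t, y) hp).isSymmSndFDerivWithinAt
      (by rw [minSmoothness_of_isRCLikeNormedField]; rfl) hSu
      (subset_closure_interior_Ici_prod hU hp) hp
  have h1 := hasDerivWithinAt_time hD ht hy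
  have h2 : HasDerivWithinAt
      (fun s => (fderivWithin ℝ f S (s, y)).comp (ContinuousLinearMap.inr ℝ ℝ E))
      ((D2 (1, 0)).comp (ContinuousLinearMap.inr ℝ ℝ E)) (Ici 0) t := by
    simpa using h1.clm_comp (hasDerivWithinAt_const t (Ici 0) (ContinuousLinearMap.inr ℝ ℝ E))
  have h3 : HasFDerivAt (fun z => f' (t, z)) ((D2.comp (ContinuousLinearMap.inr ℝ ℝ E)).flip (1, 0))
      y := by
    have h4 := (hasFDerivAt_space hU hD ht hy).clm_apply (hasFDerivAt_const ((1 : ℝ), (0 : E)) y)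
    refine HasFDerivAt.congr_of_eventuallyEq (f := fun z => fderivWithin ℝ f S (t, z) (1, 0))
      (by simpa using h4) ?_
    filter_upwards [hU.mem_nhds hy] with z hz
    exact fderivWithin_apply_eq_of_hasDerivWithinAt hf hf' ⟨ht, hz⟩
  rw [h3.fderiv]
  have h5 : (D2.comp (ContinuousLinearMap.inr ℝ ℝ E)).flip (1, 0) =
      (D2 (1, 0)).comp (ContinuousLinearMap.inr ℝ ℝ E) := by
    ext v
    exact hsymm _ _
  rw [h5]
  exact h2.congr (fun s hs => (hasFDerivAt_space hU hf hs hy).fderiv)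
    (hasFDerivAt_space hU hf ht hy).fderiv

end TimeDerivative

/-! ### Linear algebra of the evolution equation -/

section Pointwise

/-- The bilinear map `(S, A) ↦ (A S - S A) / 2` on endomorphisms. -/
def halfBracket (E : Type u) [NormedAddCommGroup E] [NormedSpace ℝ E] :
    (E →L[ℝ] E) →L[ℝ] (E →L[ℝ] E) →L[ℝ] (E →L[ℝ] E) :=
  (1 / 2 : ℝ) • ((ContinuousLinearMap.compL ℝ E E E).flip - ContinuousLinearMap.compL ℝ E E E)

/-- This supplies the Grönwall rate ‖S‖ for quantities evolving by ½[·, S]. -/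
lemma norm_half_bracket_le (S A : E →L[ℝ] E) :
    ‖(1 / 2 : ℝ) • (A ∘L S - S ∘L A)‖ ≤ ‖S‖ * ‖A‖ := by
  rw [norm_smul, Real.norm_of_nonneg (by norm_num)]
  have h := (norm_sub_le (A ∘L S) (S ∘L A)).trans
    (add_le_add (A.opNorm_comp_le S) (S.opNorm_comp_le A))
  linarith [mul_comm ‖A‖ ‖S‖]

lemma norm_half_add_le {x y : W} {c : ℝ} (hx : ‖x‖ ≤ c) (hy : ‖y‖ ≤ c) :
    ‖(1 / 2 : ℝ) • (x + y)‖ ≤ c := by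
  rw [norm_smul, Real.norm_of_nonneg (by norm_num)]
  linarith [norm_add_le x y]

lemma _root_.HasDerivWithinAt.clm_map {V : Type u} [NormedAddCommGroup V] [NormedSpace ℝ V]
    {f : ℝ → V} {f' : V} {s : Set ℝ} {t : ℝ} (hf : HasDerivWithinAt f f' s t) (L : V →L[ℝ] W) :
    HasDerivWithinAt (fun r => L (f r)) (L f') s t :=
  L.hasFDerivAt.comp_hasDerivWithinAt t hf

/-- Exchanging the arguments of a bilinear form, as a continuous linear map. -/
def flipL (E : Type u) [NormedAddCommGroup E] [NormedSpace ℝ E] :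
    (E →L[ℝ] E →L[ℝ] ℝ) →L[ℝ] (E →L[ℝ] E →L[ℝ] ℝ) :=
  (ContinuousLinearMap.flipₗᵢ ℝ E E ℝ).toContinuousLinearEquiv

@[simp]
lemma flipL_apply (B : E →L[ℝ] E →L[ℝ] ℝ) : flipL E B = B.flip := rfl

variable {S J : ℝ → E →L[ℝ] E}

/-- The bracket with S is a derivation that kills the identity, so J² + 1 obeys the same equation as
J. -/
lemma comp_self_eq_neg_one_of_ode (hS : ContinuousOn S (Ici 0))
    (hJ : ∀ t : ℝ, 0 ≤ t →
      HasDerivWithinAt J ((1 / 2 : ℝ) • (J t ∘L S t - S t ∘L J t)) (Ici 0) t)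
    (h0 : J 0 ∘L J 0 = -ContinuousLinearMap.id ℝ E) {t : ℝ} (ht : 0 ≤ t) :
    J t ∘L J t = -ContinuousLinearMap.id ℝ E := by
  have h := eq_zero_of_norm_deriv_le (k := fun t => ‖S t‖)
    (w := fun t => J t ∘L J t + ContinuousLinearMap.id ℝ E)
    (w' := fun t => (1 / 2 : ℝ) • ((J t ∘L J t + ContinuousLinearMap.id ℝ E) ∘L S t -
      S t ∘L (J t ∘L J t + ContinuousLinearMap.id ℝ E))) hS.norm ?_
    (fun t _ => norm_half_bracket_le _ _) (by simp [h0]) ht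
  · exact eq_neg_of_add_eq_zero_left h
  · intro t ht
    have h1 := ((hJ t ht).clm_comp (hJ t ht)).add_const (ContinuousLinearMap.id ℝ E)
    convert h1 using 1
    ext v
    simp only [ContinuousLinearMap.comp_apply, smul_apply,
      sub_apply, add_apply, ContinuousLinearMap.id_apply,
      map_sub, map_add, map_smul]
    module

/-- Skewness replaces invariance because it is linear in J. With Ġ = G(S·,·), half of G(Su, Jv) is
rewritten as ½G(u, SJv) by self-adjointness and cancels a term of J̇; ½G(SJu, v) becomes ½G(Ju, Sv).
What remains is ½(H(S·,·) + H(·,S·)). -/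
lemma skew_of_ode (hS : ContinuousOn S (Ici 0))
    (hJ : ∀ t : ℝ, 0 ≤ t →
      HasDerivWithinAt J ((1 / 2 : ℝ) • (J t ∘L S t - S t ∘L J t)) (Ici 0) t)
    {G : ℝ → E →L[ℝ] E →L[ℝ] ℝ}
    (hG : ∀ t : ℝ, 0 ≤ t → HasDerivWithinAt G (G t ∘L S t) (Ici 0) t)
    (hsymm : ∀ t : ℝ, 0 ≤ t → ∀ u v, G t (S t u) v = G t u (S t v))
    (h0 : ∀ u v, G 0 (J 0 u) v + G 0 u (J 0 v) = 0) {t : ℝ} (ht : 0 ≤ t) (u v : E) :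
    G t (J t u) v + G t u (J t v) = 0 := by
  set H : ℝ → E →L[ℝ] E →L[ℝ] ℝ := fun t => G t ∘L J t + ((G t).flip ∘L J t).flip with hH
  have h := eq_zero_of_norm_deriv_le (k := fun t => ‖S t‖) (w := H)
    (w' := fun t => (1 / 2 : ℝ) • (H t ∘L S t + ((H t).flip ∘L S t).flip)) hS.norm ?_ ?_ ?_ ht
  · exact DFunLike.congr_fun (DFunLike.congr_fun h u) v
  · intro t ht
    have hflip := (hG t ht).clm_map (flipL E)
    have h1 := ((hG t ht).clm_comp (hJ t ht)).add
      ((hflip.clm_comp (hJ t ht)).clm_map (flipL E))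
    refine HasDerivWithinAt.congr_deriv h1 ?_
    ext u v
    have e1 := hsymm t ht (J t u) v
    have e2 := hsymm t ht u (J t v)
    simp only [hH, flipL_apply, ContinuousLinearMap.comp_apply, smul_apply, add_apply, sub_apply,
      ContinuousLinearMap.flip_apply, map_sub, map_smul, smul_eq_mul]
    linear_combination (1 / 2 : ℝ) * e2 + (1 / 2 : ℝ) * e1
  · intro t _
    have h1 := (H t).opNorm_comp_le (S t)
    have h2 := (H t).flip.opNorm_comp_le (S t)
    rw [ContinuousLinearMap.opNorm_flip] at h2
    rw [mul_comm] at h1 h2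
    exact norm_half_add_le h1 ((ContinuousLinearMap.opNorm_flip _).trans_le h2)
  · ext u v
    exact h0 u v

end Pointwise

end KahlerVariation

end

noncomputable section

namespace KahlerVariation

universe u

open scoped Topology

variable {E : Type u} [NormedAddCommGroup E] [NormedSpace ℝ E]

/-! ### The Levi-Civita connection in coordinates -/

section Coordinates

/-- The covector part of the Christoffel symbol: `(2 G(Γ(ξ, v), w))` as a function of `v, w`. -/
def christoffelForm (D : E →L[ℝ] E →L[ℝ] E →L[ℝ] ℝ) (ξ : E) : E →L[ℝ] E →L[ℝ] ℝ :=
  D ξ + D.flip ξ - (D.flip ξ).flip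

lemma christoffelForm_apply (D : E →L[ℝ] E →L[ℝ] E →L[ℝ] ℝ) (ξ v w : E) :
    christoffelForm D ξ v w = D ξ v w + D v ξ w - D w ξ v := rfl

/-- The endomorphism `η ↦ Γ(ξ, η)`. -/
def christoffelMap (G : E → E →L[ℝ] E →L[ℝ] ℝ) (y ξ : E) : E →L[ℝ] E :=
  (1 / 2 : ℝ) • ((G y).inverse ∘L christoffelForm (fderiv ℝ G y) ξ)

/-- The covariant derivative in the direction `ξ` of a field of endomorphisms, in coordinates. -/
def chartCovDeriv (G : E → E →L[ℝ] E →L[ℝ] ℝ) (A : E → E →L[ℝ] E) (y ξ : E) : E →L[ℝ] E :=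
  fderiv ℝ A y ξ + christoffelMap G y ξ ∘L A y - A y ∘L christoffelMap G y ξ

lemma _root_.ContinuousLinearMap.IsInvertible.apply_inverse {M N : Type u}
    [NormedAddCommGroup M] [NormedSpace ℝ M] [NormedAddCommGroup N] [NormedSpace ℝ N]
    {f : M →L[ℝ] N} (hf : f.IsInvertible) (x : N) : f (f.inverse x) = x := by
  obtain ⟨e, rfl⟩ := hf
  simp

variable {G V : E → E →L[ℝ] E →L[ℝ] ℝ} {S : E → E →L[ℝ] E} {y : E}

lemma metric_christoffel (hinv : (G y).IsInvertible) (u v w : E) :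
    G y (christoffelMap G y u v) w =
      (1 / 2 : ℝ) * (fderiv ℝ G y u v w + fderiv ℝ G y v u w - fderiv ℝ G y w u v) := by
  have h : G y (christoffelMap G y u v) =
      (1 / 2 : ℝ) • christoffelForm (fderiv ℝ G y) u v := by
    simp only [christoffelMap, smul_apply, ContinuousLinearMap.comp_apply, map_smul,
      hinv.apply_inverse]
  rw [h, smul_apply, christoffelForm_apply, smul_eq_mul]

lemma fderiv_symm (hG : DifferentiableAt ℝ G y) (hsymm : ∀ᶠ z in 𝓝 y, ∀ u v, G z u v = G z v u)
    (w u v : E) : fderiv ℝ G y w u v = fderiv ℝ G y w v u := by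
  have h1 : G =ᶠ[𝓝 y] fun z => flipL E (G z) := by
    filter_upwards [hsymm] with z hz
    ext u v
    exact hz u v
  have h2 : fderiv ℝ G y = (flipL E).comp (fderiv ℝ G y) := by
    conv_lhs => rw [h1.fderiv_eq]
    exact ((flipL E).hasFDerivAt.comp y hG.hasFDerivAt).fderiv
  exact DFunLike.congr_fun (DFunLike.congr_fun (DFunLike.congr_fun h2 w) u) v

lemma christoffelMap_symm (hG : DifferentiableAt ℝ G y)
    (hsymm : ∀ᶠ z in 𝓝 y, ∀ u v, G z u v = G z v u) (u v : E) :
    christoffelMap G y u v = christoffelMap G y v u := by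
  have h : christoffelForm (fderiv ℝ G y) u v = christoffelForm (fderiv ℝ G y) v u := by
    ext w
    rw [christoffelForm_apply, christoffelForm_apply, fderiv_symm hG hsymm w u v]
    ring
  simp only [christoffelMap, smul_apply, ContinuousLinearMap.comp_apply, h]

lemma metric_compatible (hG : DifferentiableAt ℝ G y) (hinv : (G y).IsInvertible)
    (hsymm : ∀ᶠ z in 𝓝 y, ∀ u v, G z u v = G z v u) (u v w : E) :
    fderiv ℝ G y u v w =
      G y (christoffelMap G y u v) w + G y v (christoffelMap G y u w) := by
  have h1 := hsymm.self_of_nhds v (christoffelMap G y u w)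
  rw [h1, metric_christoffel hinv, metric_christoffel hinv, fderiv_symm hG hsymm u w v,
    fderiv_symm hG hsymm w u v, fderiv_symm hG hsymm v u w]
  ring

/-- The derivative of the tensor `V = G(S ·, ·)` in terms of the covariant derivative of `S`. -/
lemma fderiv_eq_chartCovDeriv (hG : DifferentiableAt ℝ G y) (hS : DifferentiableAt ℝ S y)
    (hinv : (G y).IsInvertible) (hsymm : ∀ᶠ z in 𝓝 y, ∀ u v, G z u v = G z v u)
    (hV : ∀ᶠ z in 𝓝 y, V z = G z ∘L S z) (u v w : E) :
    fderiv ℝ V y u v w = G y (chartCovDeriv G S y u v) w + V y v (christoffelMap G y u w) +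
      V y (christoffelMap G y u v) w := by
  have h1 : fderiv ℝ V y u = G y ∘L fderiv ℝ S y u + fderiv ℝ G y u ∘L S y := by
    rw [Filter.EventuallyEq.fderiv_eq hV, (hG.hasFDerivAt.clm_comp hS.hasFDerivAt).fderiv]
    rfl
  rw [h1, hV.self_of_nhds]
  simp only [add_apply, ContinuousLinearMap.comp_apply, chartCovDeriv, sub_apply, map_add, map_sub,
    metric_compatible hG hinv hsymm]
  ring

/-- Variation of the Christoffel symbols in a direction `V` with `S = G⁻¹ V` closed. -/
lemma christoffel_variation (hG : DifferentiableAt ℝ G y) (hS : DifferentiableAt ℝ S y)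
    (hinv : (G y).IsInvertible) (hsymm : ∀ᶠ z in 𝓝 y, ∀ u v, G z u v = G z v u)
    (hVdiff : DifferentiableAt ℝ V y) (hVsymm : ∀ᶠ z in 𝓝 y, ∀ u v, V z u v = V z v u)
    (hV : ∀ᶠ z in 𝓝 y, V z = G z ∘L S z)
    (hclosed : ∀ u v, chartCovDeriv G S y u v = chartCovDeriv G S y v u) (u v w : E) :
    (1 / 2 : ℝ) * christoffelForm (fderiv ℝ V y) u v w =
      (1 / 2 : ℝ) * G y (chartCovDeriv G S y u v) w + V y (christoffelMap G y u v) w := by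
  have hd := fderiv_eq_chartCovDeriv hG hS hinv hsymm hV
  have hs := hVsymm.self_of_nhds
  -- Symmetry of V makes G((∇_a S)b, c) symmetric in b, c. With closedness it is totally symmetric,
  -- so the three derivatives in Koszul's formula contribute a single copy of it plus Christoffel
  -- terms.
  have hsw : ∀ a b c, G y (chartCovDeriv G S y a b) c = G y (chartCovDeriv G S y a c) b := by
    intro a b c
    have h1 := fderiv_symm hVdiff hVsymm a b c
    rw [hd, hd] at h1
    linarith [hs b (christoffelMap G y a c), hs (christoffelMap G y a b) c]
  have e1 : G y (chartCovDeriv G S y w u) v = G y (chartCovDeriv G S y u v) w := by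
    rw [hclosed w u, hsw]
  have hΓ := christoffelMap_symm hG hsymm
  rw [christoffelForm_apply, hd, hd, hd, e1, hclosed v u, hΓ v u, hΓ v w, hΓ w u,
    hs u (christoffelMap G y w v)]
  linarith [hs (christoffelMap G y u w) v]

end Coordinates

/-! ### Evolution of the Christoffel symbols and of the covariant derivative -/

section Evolution

variable {U : Set E} {G V : ℝ × E → E →L[ℝ] E →L[ℝ] ℝ} {S a : ℝ × E → E →L[ℝ] E}

lemma contDiffOn_inverse [CompleteSpace E] {D : Set (ℝ × E)} (hG : ContDiffOn ℝ ∞ G D)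
    (hinv : ∀ p ∈ D, (G p).IsInvertible) : ContDiffOn ℝ ∞ (fun p => (G p).inverse) D :=
  fun p hp => (hinv p hp).contDiffAt_map_inverse.comp_contDiffWithinAt p (hG p hp)

lemma hasDerivWithinAt_christoffelMap [CompleteSpace E] (hU : IsOpen U)
    (hG : ContDiffOn ℝ ∞ G (Ici 0 ×ˢ U))
    (hsymm : ∀ p ∈ Ici (0 : ℝ) ×ˢ U, ∀ u v, G p u v = G p v u)
    (hinv : ∀ p ∈ Ici (0 : ℝ) ×ˢ U, (G p).IsInvertible)
    (hV : ∀ y ∈ U, ∀ t : ℝ, 0 ≤ t → HasDerivWithinAt (fun s => G (s, y)) (V (t, y)) (Ici 0) t)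
    (hVsymm : ∀ p ∈ Ici (0 : ℝ) ×ˢ U, ∀ u v, V p u v = V p v u)
    (hS : ContDiffOn ℝ ∞ S (Ici 0 ×ˢ U))
    (hVS : ∀ p ∈ Ici (0 : ℝ) ×ˢ U, V p = G p ∘L S p) {y : E} (hy : y ∈ U) {t : ℝ} (ht : 0 ≤ t)
    (hclosed : ∀ u v, chartCovDeriv (fun z => G (t, z)) (fun z => S (t, z)) y u v =
      chartCovDeriv (fun z => G (t, z)) (fun z => S (t, z)) y v u) (ξ : E) :
    HasDerivWithinAt (fun s => christoffelMap (fun z => G (s, z)) y ξ)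
      ((1 / 2 : ℝ) • chartCovDeriv (fun z => G (t, z)) (fun z => S (t, z)) y ξ) (Ici 0) t := by
  have hVn := contDiffOn_time_deriv hU hG hV
  have hmem : ∀ᶠ z in 𝓝 y, (t, z) ∈ Ici (0 : ℝ) ×ˢ U := by
    filter_upwards [hU.mem_nhds hy] with z hz using ⟨ht, hz⟩
  have hdG := hasDerivWithinAt_fderiv hU hG hV ht hy
  set c : ℝ → E →L[ℝ] E →L[ℝ] ℝ :=
    fun s => (1 / 2 : ℝ) • christoffelForm (fderiv ℝ (fun z => G (s, z)) y) ξ with hc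
  have hform : HasDerivWithinAt c
      ((1 / 2 : ℝ) • christoffelForm (fderiv ℝ (fun z => V (t, z)) y) ξ) (Ici 0) t := by
    have h1 := hdG.clm_map (ContinuousLinearMap.apply ℝ (E →L[ℝ] E →L[ℝ] ℝ) ξ)
    have h2 := hdG.clm_map ((ContinuousLinearMap.apply ℝ (E →L[ℝ] E →L[ℝ] ℝ) ξ).comp
      ((ContinuousLinearMap.flipₗᵢ ℝ E E (E →L[ℝ] ℝ)).toContinuousLinearEquiv :
        (E →L[ℝ] E →L[ℝ] E →L[ℝ] ℝ) →L[ℝ] (E →L[ℝ] E →L[ℝ] E →L[ℝ] ℝ)))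
    exact ((h1.add h2).sub (h2.clm_map (flipL E))).const_smul (1 / 2 : ℝ)
  -- Only differentiability is taken from the inverse. The value of Γ' comes from differentiating G
  -- ∘ Γ = c: the term V ∘ Γ cancels against `christoffel_variation`, and G is injective.
  have hinverse : DifferentiableWithinAt ℝ (fun s => (G (s, y)).inverse) (Ici 0) t :=
    (hasDerivWithinAt_time (contDiffOn_inverse hG hinv) ht hy).differentiableWithinAt
  have hΓ : DifferentiableWithinAt ℝ (fun s => christoffelMap (fun z => G (s, z)) y ξ)
      (Ici 0) t := by
    refine (hinverse.clm_comp hform.differentiableWithinAt).congr (fun s hs => ?_) ?_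
    all_goals
      ext v
      simp [christoffelMap, hc]
  have hd := hΓ.hasDerivWithinAt
  set Γ' := derivWithin (fun s => christoffelMap (fun z => G (s, z)) y ξ) (Ici 0) t with hΓ'
  have hprod := (hV y hy t ht).clm_comp hd
  have heq : ∀ s ∈ Ici (0 : ℝ), c s = G (s, y) ∘L christoffelMap (fun z => G (s, z)) y ξ := by
    intro s hs
    ext v w
    rw [ContinuousLinearMap.comp_apply,
      metric_christoffel (G := fun z => G (s, z)) (hinv (s, y) ⟨hs, hy⟩)]
    rfl
  have hform' := hform.congr (fun s hs => (heq s hs).symm) (heq t ht).symm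
  have hkey := (uniqueDiffOn_Ici 0 t ht).eq_deriv _ hprod hform'
  have hdiff : ∀ {f : ℝ × E → E →L[ℝ] E →L[ℝ] ℝ}, ContDiffOn ℝ ∞ f (Ici 0 ×ˢ U) →
      DifferentiableAt ℝ (fun z => f (t, z)) y :=
    fun hf => (hasFDerivAt_space hU hf ht hy).differentiableAt
  suffices h : Γ' = (1 / 2 : ℝ) • chartCovDeriv (fun z => G (t, z)) (fun z => S (t, z)) y ξ by
    rwa [h] at hd
  have hinj : Function.Injective (G (t, y)) := by
    obtain ⟨e, he⟩ := hinv (t, y) ⟨ht, hy⟩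
    rw [← he]
    exact e.injective
  ext v
  refine hinj ?_
  ext w
  have h1 := DFunLike.congr_fun (DFunLike.congr_fun hkey v) w
  have h2 := christoffel_variation (G := fun z => G (t, z)) (V := fun z => V (t, z))
    (S := fun z => S (t, z)) (y := y) (hdiff hG)
    (hasFDerivAt_space hU hS ht hy).differentiableAt (hinv (t, y) ⟨ht, hy⟩)
    (hmem.mono fun z hz => hsymm _ hz) (hdiff hVn) (hmem.mono fun z hz => hVsymm _ hz)
    (hmem.mono fun z hz => hVS _ hz) hclosed ξ v w
  simp only [add_apply, ContinuousLinearMap.comp_apply, smul_apply, smul_eq_mul, map_smul] at h1 h2 ⊢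
  linarith

/-- The covariant derivative of a solution of the evolution equation stays zero. -/
theorem chartCovDeriv_eq_zero_of_ode [CompleteSpace E] (hU : IsOpen U)
    (hG : ContDiffOn ℝ ∞ G (Ici 0 ×ˢ U))
    (hsymm : ∀ p ∈ Ici (0 : ℝ) ×ˢ U, ∀ u v, G p u v = G p v u)
    (hinv : ∀ p ∈ Ici (0 : ℝ) ×ˢ U, (G p).IsInvertible)
    (hV : ∀ y ∈ U, ∀ t : ℝ, 0 ≤ t → HasDerivWithinAt (fun s => G (s, y)) (V (t, y)) (Ici 0) t)
    (hVsymm : ∀ p ∈ Ici (0 : ℝ) ×ˢ U, ∀ u v, V p u v = V p v u)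
    (hS : ContDiffOn ℝ ∞ S (Ici 0 ×ˢ U))
    (hVS : ∀ p ∈ Ici (0 : ℝ) ×ˢ U, V p = G p ∘L S p)
    (ha : ContDiffOn ℝ ∞ a (Ici 0 ×ˢ U))
    (hode : ∀ y ∈ U, ∀ t : ℝ, 0 ≤ t → HasDerivWithinAt (fun s => a (s, y))
      ((1 / 2 : ℝ) • (a (t, y) ∘L S (t, y) - S (t, y) ∘L a (t, y))) (Ici 0) t)
    {y : E} (hy : y ∈ U)
    (hclosed : ∀ t : ℝ, 0 ≤ t → ∀ u v,
      chartCovDeriv (fun z => G (t, z)) (fun z => S (t, z)) y u v =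
        chartCovDeriv (fun z => G (t, z)) (fun z => S (t, z)) y v u) (ξ : E)
    (h0 : chartCovDeriv (fun z => G (0, z)) (fun z => a (0, z)) y ξ = 0) {t : ℝ} (ht : 0 ≤ t) :
    chartCovDeriv (fun z => G (t, z)) (fun z => a (t, z)) y ξ = 0 := by
  have hScont : ContinuousOn (fun t => S (t, y)) (Ici 0) :=
    hS.continuousOn.comp (by fun_prop) fun s hs => ⟨hs, hy⟩
  refine eq_zero_of_norm_deriv_le (k := fun t => ‖S (t, y)‖)
    (w := fun t => chartCovDeriv (fun z => G (t, z)) (fun z => a (t, z)) y ξ)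
    (w' := fun t => (1 / 2 : ℝ) •
      (chartCovDeriv (fun z => G (t, z)) (fun z => a (t, z)) y ξ ∘L S (t, y) -
        S (t, y) ∘L chartCovDeriv (fun z => G (t, z)) (fun z => a (t, z)) y ξ))
    hScont.norm ?_ (fun t _ => norm_half_bracket_le _ _) h0 ht
  intro t ht
  have hΓ := hasDerivWithinAt_christoffelMap hU hG hsymm hinv hV hVsymm hS hVS hy ht
    (hclosed t ht) ξ
  have hda := (hasDerivWithinAt_fderiv (f' := fun p => (1 / 2 : ℝ) • (a p ∘L S p - S p ∘L a p))
    hU ha hode ht hy).clm_map (ContinuousLinearMap.apply ℝ (E →L[ℝ] E) ξ)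
  have hat := hode y hy t ht
  -- The derivative is ∇_ξ(½[a, S]) + [Γ', a] with Γ' = ½∇_ξ S; the two terms containing ∇_ξ S
  -- cancel.
  refine HasDerivWithinAt.congr_deriv
    ((hda.add (hΓ.clm_comp hat)).sub (hat.clm_comp hΓ)) ?_
  have ha1 := hasFDerivAt_space hU ha ht hy
  have hS1 := hasFDerivAt_space hU hS ht hy
  have h1 : fderiv ℝ (fun z => (1 / 2 : ℝ) • (a (t, z) ∘L S (t, z) - S (t, z) ∘L a (t, z))) y ξ =
      (1 / 2 : ℝ) • (a (t, y) ∘L fderiv ℝ (fun z => S (t, z)) y ξ +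
        fderiv ℝ (fun z => a (t, z)) y ξ ∘L S (t, y) -
        (S (t, y) ∘L fderiv ℝ (fun z => a (t, z)) y ξ +
          fderiv ℝ (fun z => S (t, z)) y ξ ∘L a (t, y))) := by
    have h2 := (((ha1.differentiableAt.hasFDerivAt.clm_comp hS1.differentiableAt.hasFDerivAt).sub
      (hS1.differentiableAt.hasFDerivAt.clm_comp ha1.differentiableAt.hasFDerivAt)).const_smul
      (1 / 2 : ℝ)).fderiv
    exact DFunLike.congr_fun h2 ξ
  rw [ContinuousLinearMap.apply_apply, h1]
  ext v
  simp only [chartCovDeriv, add_apply, sub_apply, smul_apply, ContinuousLinearMap.comp_apply,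
    map_add, map_sub, map_smul]
  module

end Evolution

end KahlerVariation

end

noncomputable section

namespace KahlerVariation

universe u v

open scoped Topology

variable {E : Type u} [NormedAddCommGroup E] [NormedSpace ℝ E]
  {X : Type v} [TopologicalSpace X] [ChartedSpace E X]

/-! ### Coordinate expressions of smooth families -/

section Charts

variable [IsManifold 𝓘(ℝ, E) ∞ X]

lemma coframe_comp_frame (x : X) {y : E} (hy : y ∈ (extChartAt 𝓘(ℝ, E) x).target) :
    coframe x y ∘L frame x y = ContinuousLinearMap.id ℝ E := by
  have h := mfderiv_extChartAt_comp_mfderivWithin_extChartAt_symm (I := 𝓘(ℝ, E)) hy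
  rw [modelWithCornersSelf_coe, range_id, mfderivWithin_univ] at h
  exact h

lemma frame_comp_coframe (x : X) {y : E} (hy : y ∈ (extChartAt 𝓘(ℝ, E) x).target) :
    frame x y ∘L coframe x y = ContinuousLinearMap.id ℝ _ := by
  have h := mfderivWithin_extChartAt_symm_comp_mfderiv_extChartAt (I := 𝓘(ℝ, E)) hy
  rw [modelWithCornersSelf_coe, range_id, mfderivWithin_univ] at h
  exact h

omit [IsManifold 𝓘(ℝ, E) ∞ X] in
lemma extChartAt_symm_mem_chartAt_source {x : X} {y : E}
    (hy : y ∈ (extChartAt 𝓘(ℝ, E) x).target) :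
    (extChartAt 𝓘(ℝ, E) x).symm y ∈ (chartAt E x).source := by
  simpa using (extChartAt 𝓘(ℝ, E) x).map_target hy

/-- Smoothness of sections is defined through bundle trivializations; this identification turns it
into smoothness of the coordinate expressions `inChart`. -/
lemma symmL_trivializationAt_eq_frame {x : X} {y : E}
    (hy : y ∈ (extChartAt 𝓘(ℝ, E) x).target) :
    (trivializationAt E (TangentSpace 𝓘(ℝ, E)) x).symmL ℝ ((extChartAt 𝓘(ℝ, E) x).symm y) =
      frame x y := by
  rw [TangentBundle.symmL_trivializationAt (extChartAt_symm_mem_chartAt_source hy),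
    (extChartAt 𝓘(ℝ, E) x).right_inv hy, modelWithCornersSelf_coe, range_id, mfderivWithin_univ]
  rfl

lemma EndField.inChart_eq (A : EndField E X) {x : X} {y : E}
    (hy : y ∈ (extChartAt 𝓘(ℝ, E) x).target) :
    A.inChart x y = (trivializationAt (E →L[ℝ] E)
      (fun x : X => TangentSpace 𝓘(ℝ, E) x →L[ℝ] TangentSpace 𝓘(ℝ, E) x) x
      ⟨(extChartAt 𝓘(ℝ, E) x).symm y, A ((extChartAt 𝓘(ℝ, E) x).symm y)⟩).2 := by
  rw [hom_trivializationAt_apply]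
  simp only [ContinuousLinearMap.inCoordinates]
  rw [TangentBundle.continuousLinearMapAt_trivializationAt
    (extChartAt_symm_mem_chartAt_source hy), symmL_trivializationAt_eq_frame hy]
  rfl

lemma FormField.inChart_eq (v : FormField E X) {x : X} {y : E}
    (hy : y ∈ (extChartAt 𝓘(ℝ, E) x).target) :
    v.inChart x y = (trivializationAt (E →L[ℝ] E →L[ℝ] ℝ)
      (fun x : X => TangentSpace 𝓘(ℝ, E) x →L[ℝ] TangentSpace 𝓘(ℝ, E) x →L[ℝ] ℝ) x
      ⟨(extChartAt 𝓘(ℝ, E) x).symm y, v ((extChartAt 𝓘(ℝ, E) x).symm y)⟩).2 := by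
  have hs : (extChartAt 𝓘(ℝ, E) x).symm y ∈
      (trivializationAt E (TangentSpace 𝓘(ℝ, E)) x).baseSet :=
    extChartAt_symm_mem_chartAt_source hy
  rw [hom_trivializationAt_apply]
  ext a b
  have hf : ∀ c : E, (trivializationAt E (TangentSpace 𝓘(ℝ, E)) x).symm
      ((extChartAt 𝓘(ℝ, E) x).symm y) c = frame x y c := by
    intro c
    rw [← symmL_trivializationAt_eq_frame hy]
    exact (Trivialization.symmL_apply _ hs c).symm
  rw [inCoordinates_apply_eq₂ hs hs (by simp), hf, hf]
  simp
  rfl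

variable {F : Type u} [NormedAddCommGroup F] [NormedSpace ℝ F] {V : X → Type u}
  [TopologicalSpace (TotalSpace F V)] [∀ x, AddCommGroup (V x)] [∀ x, Module ℝ (V x)]
  [∀ x, TopologicalSpace (V x)] [FiberBundle F V] [VectorBundle ℝ F V]
  [ContMDiffVectorBundle ∞ F V 𝓘(ℝ, E)]

lemma contDiffOn_trivialization_of_family {s : ∀ _ : ℝ, ∀ x : X, V x}
    (hs : ContMDiffOn (𝓘(ℝ, ℝ).prod 𝓘(ℝ, E)) (𝓘(ℝ, E).prod 𝓘(ℝ, F)) ∞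
      (fun p : ℝ × X => TotalSpace.mk' F p.2 (s p.1 p.2)) (Ici 0 ×ˢ univ)) {x : X}
    (hx : (chartAt E x).source ⊆ (trivializationAt F V x).baseSet) :
    ContDiffOn ℝ ∞ (fun p : ℝ × E => (trivializationAt F V x
      ⟨(extChartAt 𝓘(ℝ, E) x).symm p.2, s p.1 ((extChartAt 𝓘(ℝ, E) x).symm p.2)⟩).2)
      (Ici 0 ×ˢ (extChartAt 𝓘(ℝ, E) x).target) := by
  rw [← contMDiffOn_iff_contDiffOn]
  have h1 : ContMDiffOn (𝓘(ℝ, ℝ).prod 𝓘(ℝ, E)) 𝓘(ℝ, F) ∞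
      (fun p : ℝ × X => (trivializationAt F V x ⟨p.2, s p.1 p.2⟩).2)
      (Ici 0 ×ˢ (chartAt E x).source) := by
    have h2 := hs.mono (prod_mono_right (subset_univ (chartAt E x).source))
    refine ((trivializationAt F V x).contMDiffOn_iff ?_).1 h2 |>.2
    intro p hp
    rw [Trivialization.mem_source]
    exact hx hp.2
  have h3 : ContMDiffOn 𝓘(ℝ, ℝ × E) (𝓘(ℝ, ℝ).prod 𝓘(ℝ, E)) ∞
      (fun p : ℝ × E => (p.1, (extChartAt 𝓘(ℝ, E) x).symm p.2))
      (Ici 0 ×ˢ (extChartAt 𝓘(ℝ, E) x).target) :=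
    contDiff_fst.contMDiff.contMDiffOn.prodMk
      ((contMDiffOn_extChartAt_symm x).comp contDiff_snd.contMDiff.contMDiffOn fun p hp => hp.2)
  exact h1.comp h3 fun p hp => ⟨hp.1, extChartAt_symm_mem_chartAt_source hp.2⟩

lemma FormField.IsSmoothFamily.contDiffOn_inChart {v : ℝ → FormField E X}
    (hv : FormField.IsSmoothFamily v) (x : X) :
    ContDiffOn ℝ ∞ (fun p : ℝ × E => (v p.1).inChart x p.2)
      (Ici 0 ×ˢ (extChartAt 𝓘(ℝ, E) x).target) := by
  refine (contDiffOn_trivialization_of_family hv fun z hz => ?_).congr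
    fun p hp => FormField.inChart_eq _ hp.2
  simpa [hom_trivializationAt_baseSet] using hz

lemma EndField.IsSmooth.contDiffOn_inChart {A : EndField E X} (hA : A.IsSmooth) (x : X) :
    ContDiffOn ℝ ∞ (A.inChart x) (extChartAt 𝓘(ℝ, E) x).target := by
  -- A single field is treated as a constant family and then restricted to t = 0.
  have h1 : ContDiffOn ℝ ∞ (fun p : ℝ × E => A.inChart x p.2)
      (Ici 0 ×ˢ (extChartAt 𝓘(ℝ, E) x).target) := by
    refine (contDiffOn_trivialization_of_family (s := fun _ => A)
      (ContMDiff.comp_contMDiffOn hA contMDiffOn_snd) fun z hz => ?_).congr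
      fun p hp => EndField.inChart_eq _ hp.2
    simpa [hom_trivializationAt_baseSet] using hz
  exact h1.comp (f := fun y => ((0 : ℝ), y)) (by fun_prop) fun y hy => ⟨self_mem_Ici, hy⟩

lemma EndField.isSmoothFamily_of_inChart {A : ℝ → EndField E X}
    (hA : ∀ x : X, ContDiffOn ℝ ∞ (fun p : ℝ × E => (A p.1).inChart x p.2)
      (Ici 0 ×ˢ (extChartAt 𝓘(ℝ, E) x).target)) : EndField.IsSmoothFamily A := by
  rintro ⟨t, x⟩ ⟨ht, -⟩
  rw [contMDiffWithinAt_totalSpace]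
  refine ⟨contMDiffWithinAt_snd, ?_⟩
  have hmem : Ici (0 : ℝ) ×ˢ (chartAt E x).source ∈
      𝓝[Ici (0 : ℝ) ×ˢ (univ : Set X)] (t, x) := by
    rw [nhdsWithin_prod_eq, nhdsWithin_univ]
    exact Filter.prod_mem_prod self_mem_nhdsWithin (chart_source_mem_nhds E x)
  have h1 : ContMDiffOn (𝓘(ℝ, ℝ).prod 𝓘(ℝ, E)) 𝓘(ℝ, ℝ × E) ∞
      (fun p : ℝ × X => (p.1, extChartAt 𝓘(ℝ, E) x p.2)) (Ici 0 ×ˢ (chartAt E x).source) :=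
    contMDiffOn_fst.prodMk_space
      ((contMDiffOn_extChartAt (x := x)).comp contMDiffOn_snd fun p hp => hp.2)
  have hm : ∀ p ∈ Ici (0 : ℝ) ×ˢ (chartAt E x).source, extChartAt 𝓘(ℝ, E) x p.2 ∈
      (extChartAt 𝓘(ℝ, E) x).target := fun p hp =>
    (extChartAt 𝓘(ℝ, E) x).map_source (by simpa using hp.2)
  have h2 := ((contMDiffOn_iff_contDiffOn.2 (hA x)).comp h1 fun p hp => ⟨hp.1, hm p hp⟩)
  have h3 := h2.congr (f₁ := fun p : ℝ × X => (trivializationAt (E →L[ℝ] E)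
      (fun x : X => TangentSpace 𝓘(ℝ, E) x →L[ℝ] TangentSpace 𝓘(ℝ, E) x) x
      ⟨p.2, A p.1 p.2⟩).2) fun p hp => by
    have h4 := EndField.inChart_eq (A p.1) (hm p hp)
    have h5 : (extChartAt 𝓘(ℝ, E) x).symm (extChartAt 𝓘(ℝ, E) x p.2) = p.2 :=
      (extChartAt 𝓘(ℝ, E) x).left_inv (by simpa using hp.2)
    rw [h5] at h4
    exact h4.symm
  exact (h3 (t, x) ⟨ht, mem_chart_source E x⟩).mono_of_mem_nhdsWithin hmem

lemma EndField.IsSmoothFamily.isSmooth {A : ℝ → EndField E X} (hA : EndField.IsSmoothFamily A)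
    {t : ℝ} (ht : 0 ≤ t) : (A t).IsSmooth := by
  have h1 : ContMDiff 𝓘(ℝ, E) (𝓘(ℝ, ℝ).prod 𝓘(ℝ, E)) ∞ (fun x : X => (t, x)) :=
    contMDiff_const.prodMk contMDiff_id
  exact ContMDiffOn.comp_contMDiff hA h1 fun x => ⟨ht, mem_univ x⟩

end Charts

/-! ### Positive definite forms -/

/-- Definiteness gives injectivity, and dim E = dim E* gives the rest. For a metric, `inverse` is
therefore a true inverse and not the default value 0. -/
lemma isInvertible_of_pos [FiniteDimensional ℝ E] {b : E →L[ℝ] E →L[ℝ] ℝ}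
    (hb : ∀ u, u ≠ 0 → 0 < b u u) : b.IsInvertible := by
  have hinj : Function.Injective b := by
    rw [injective_iff_map_eq_zero]
    intro u hu
    by_contra h
    simpa [hu] using hb u h
  have hdim : Module.finrank ℝ E = Module.finrank ℝ (E →L[ℝ] ℝ) := by
    rw [← (LinearMap.toContinuousLinearMap (𝕜 := ℝ) (E := E) (F' := ℝ)).finrank_eq]
    exact Subspace.dual_finrank_eq.symm
  have hsurj : Function.Surjective b :=
    (LinearMap.injective_iff_surjective_of_finrank_eq_finrank hdim
      (f := (b : E →ₗ[ℝ] E →L[ℝ] ℝ))).1 hinj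
  exact ⟨(LinearEquiv.ofBijective (b : E →ₗ[ℝ] E →L[ℝ] ℝ) ⟨hinj, hsurj⟩).toContinuousLinearEquiv,
    rfl⟩

/-- Pulling back bilinear forms along an endomorphism, as a continuous linear map. -/
def pullbackL (f : E →L[ℝ] E) : (E →L[ℝ] E →L[ℝ] ℝ) →L[ℝ] (E →L[ℝ] E →L[ℝ] ℝ) :=
  flipL E ∘L (ContinuousLinearMap.compL ℝ E E (E →L[ℝ] ℝ)).flip f ∘L flipL E ∘L
    (ContinuousLinearMap.compL ℝ E E (E →L[ℝ] ℝ)).flip f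

/-- Conjugation of endomorphisms, as a continuous linear map. -/
def conjL (c f : E →L[ℝ] E) : (E →L[ℝ] E) →L[ℝ] (E →L[ℝ] E) :=
  ContinuousLinearMap.compL ℝ E E E c ∘L (ContinuousLinearMap.compL ℝ E E E).flip f

lemma conjL_apply (c f A : E →L[ℝ] E) : conjL c f A = c ∘L A ∘L f := rfl

end KahlerVariation

end

noncomputable section

namespace KahlerVariation

universe u v

open scoped Topology

variable {E : Type u} [NormedAddCommGroup E] [NormedSpace ℝ E]

/-! ### Change of frame -/

section Frame

variable {f c : E →L[ℝ] E}

lemma pullbackL_bilinearComp (hfc : ∀ u, f (c u) = u) (b : E →L[ℝ] E →L[ℝ] ℝ) :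
    pullbackL c (b.bilinearComp f f) = b := by
  ext u w
  change b (f (c u)) (f (c w)) = b u w
  rw [hfc, hfc]

lemma conjL_conj (hfc : ∀ u, f (c u) = u) (A : E →L[ℝ] E) : conjL f c (c ∘L A ∘L f) = A := by
  ext u
  change f (c (A (f (c u)))) = A u
  rw [hfc, hfc]

lemma bilinearComp_isInvertible [FiniteDimensional ℝ E] (hcf : ∀ u, c (f u) = u)
    {b : E →L[ℝ] E →L[ℝ] ℝ} (hb : ∀ u, u ≠ 0 → 0 < b u u) : (b.bilinearComp f f).IsInvertible :=
  isInvertible_of_pos fun u hu => hb _ fun h => hu <| by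
    rw [← hcf u, show f u = 0 from h, map_zero]

lemma bilinearComp_comp (hfc : ∀ u, f (c u) = u) (b : E →L[ℝ] E →L[ℝ] ℝ) (A : E →L[ℝ] E) :
    (b ∘L A).bilinearComp f f = b.bilinearComp f f ∘L (c ∘L A ∘L f) := by
  ext u w
  change b (A (f u)) (f w) = b (f (c (A (f u)))) (f w)
  rw [hfc]

lemma conjL_half_bracket (hfc : ∀ u, f (c u) = u) (A S : E →L[ℝ] E) :
    conjL c f ((1 / 2 : ℝ) • (A ∘L S - S ∘L A)) =
      (1 / 2 : ℝ) • (conjL c f A ∘L conjL c f S - conjL c f S ∘L conjL c f A) := by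
  ext u
  simp [conjL_apply, hfc]

end Frame

variable {X : Type v} [TopologicalSpace X] [ChartedSpace E X] [IsManifold 𝓘(ℝ, E) ∞ X]

lemma frame_coframe_apply (x : X) {y : E} (hy : y ∈ (extChartAt 𝓘(ℝ, E) x).target) (u : E) :
    frame x y (coframe x y u) = u :=
  DFunLike.congr_fun (frame_comp_coframe x hy) u

lemma coframe_frame_apply (x : X) {y : E} (hy : y ∈ (extChartAt 𝓘(ℝ, E) x).target) (u : E) :
    coframe x y (frame x y u) = u :=
  DFunLike.congr_fun (coframe_comp_frame x hy) u

omit [IsManifold 𝓘(ℝ, E) ∞ X] in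
lemma FormField.inChart_symm {v : FormField E X} (hv : ∀ q ξ η, v q ξ η = v q η ξ) (x : X)
    (y u w : E) : v.inChart x y u w = v.inChart x y w u :=
  hv _ (frame x y u) (frame x y w)

/-- A linear map independent of the field recovers its value at q from coordinates, so regularity in
t passes from the chart to the fibre. -/
lemma FormField.pullbackL_inChart (v : FormField E X) (q : X) :
    pullbackL (E := E) (coframe q (extChartAt 𝓘(ℝ, E) q q))
      (v.inChart q (extChartAt 𝓘(ℝ, E) q q)) = v q := by
  have h := pullbackL_bilinearComp (E := E)
    (frame_coframe_apply q (mem_extChartAt_target (I := 𝓘(ℝ, E)) q))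
    (v ((extChartAt 𝓘(ℝ, E) q).symm (extChartAt 𝓘(ℝ, E) q q)))
  refine Eq.trans h ?_
  rw [extChartAt_to_inv]

lemma EndField.conjL_inChart (A : EndField E X) (q : X) :
    conjL (E := E) (frame q (extChartAt 𝓘(ℝ, E) q q)) (coframe q (extChartAt 𝓘(ℝ, E) q q))
      (A.inChart q (extChartAt 𝓘(ℝ, E) q q)) = A q := by
  have h := conjL_conj (E := E)
    (frame_coframe_apply q (mem_extChartAt_target (I := 𝓘(ℝ, E)) q))
    (A ((extChartAt 𝓘(ℝ, E) q).symm (extChartAt 𝓘(ℝ, E) q q)))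
  refine Eq.trans h ?_
  rw [extChartAt_to_inv]

/-! ### Variation of a metric in coordinates -/

section FiniteDimensional

variable [FiniteDimensional ℝ E]

lemma inner_comp_sharp (g : Metric E X) (v : FormField E X) (q : X) :
    g.inner q ∘L sharp g v q = v q := by
  ext1 u
  exact ContinuousLinearMap.IsInvertible.apply_inverse (M := E) (N := E →L[ℝ] ℝ)
    (isInvertible_of_pos (E := E) (b := g.inner q) fun u hu => g.pos q u hu) (v q u)

lemma inChart_metric_isInvertible (g : Metric E X) (x : X) {y : E}
    (hy : y ∈ (extChartAt 𝓘(ℝ, E) x).target) :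
    (FormField.inChart g.inner x y).IsInvertible :=
  bilinearComp_isInvertible (E := E) (coframe_frame_apply x hy) fun u hu => g.pos _ u hu

lemma inChart_eq_comp_sharp (g : Metric E X) (v : FormField E X) (x : X) {y : E}
    (hy : y ∈ (extChartAt 𝓘(ℝ, E) x).target) :
    v.inChart x y = FormField.inChart g.inner x y ∘L (sharp g v).inChart x y := by
  have h := bilinearComp_comp (E := E) (frame_coframe_apply x hy)
    (g.inner ((extChartAt 𝓘(ℝ, E) x).symm y)) (sharp g v ((extChartAt 𝓘(ℝ, E) x).symm y))
  refine Eq.trans ?_ h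
  exact congrArg (fun b : E →L[ℝ] E →L[ℝ] ℝ => b.bilinearComp (frame x y) (frame x y))
    (inner_comp_sharp g v _).symm

end FiniteDimensional

variable {g : ℝ → Metric E X} {J : ℝ → EndField E X}

/-- Joint smoothness ensures that the `derivWithin` in `metricDeriv` is a genuine derivative rather
than the default 0. -/
lemma hasDerivWithinAt_inner (hg : FormField.IsSmoothFamily (fun t => (g t).inner)) (q : X)
    {t : ℝ} (ht : 0 ≤ t) :
    HasDerivWithinAt (F := E →L[ℝ] E →L[ℝ] ℝ) (fun s => (g s).inner q) (metricDeriv g t q)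
      (Ici 0) t := by
  have h1 := (hasDerivWithinAt_time (hg.contDiffOn_inChart q) ht
    (mem_extChartAt_target q)).clm_map
    (pullbackL (E := E) (coframe q (extChartAt 𝓘(ℝ, E) q q)))
  simp only [FormField.pullbackL_inChart] at h1
  exact h1.differentiableWithinAt.hasDerivWithinAt

lemma hasDerivWithinAt_inChart_inner (hg : FormField.IsSmoothFamily (fun t => (g t).inner))
    (x : X) (y : E) {t : ℝ} (ht : 0 ≤ t) :
    HasDerivWithinAt (fun s => FormField.inChart (g s).inner x y)
      ((metricDeriv g t).inChart x y) (Ici 0) t :=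
  (hasDerivWithinAt_inner hg ((extChartAt 𝓘(ℝ, E) x).symm y) ht).clm_map
    (pullbackL (E := E) (frame x y))

lemma SolvesODE.inChart (hJ : SolvesODE J g) (x : X) {y : E}
    (hy : y ∈ (extChartAt 𝓘(ℝ, E) x).target) {t : ℝ} (ht : 0 ≤ t) :
    HasDerivWithinAt (fun s => (J s).inChart x y)
      ((1 / 2 : ℝ) • ((J t).inChart x y ∘L (sharp (g t) (metricDeriv g t)).inChart x y -
        (sharp (g t) (metricDeriv g t)).inChart x y ∘L (J t).inChart x y)) (Ici 0) t := by
  have h := (hJ t ht ((extChartAt 𝓘(ℝ, E) x).symm y)).clm_map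
    (conjL (E := E) (coframe x y) (frame x y))
  exact h.congr_deriv (conjL_half_bracket (E := E) (frame_coframe_apply x hy) _ _)

variable [FiniteDimensional ℝ E]

lemma contDiffOn_inChart_sharp (hg : FormField.IsSmoothFamily (fun t => (g t).inner)) (x : X) :
    ContDiffOn ℝ ∞ (fun p : ℝ × E => (sharp (g p.1) (metricDeriv g p.1)).inChart x p.2)
      (Ici 0 ×ˢ (extChartAt 𝓘(ℝ, E) x).target) := by
  have := FiniteDimensional.complete ℝ E
  have hG := hg.contDiffOn_inChart x
  have hV := contDiffOn_time_deriv (isOpen_extChartAt_target x) hG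
    (f' := fun p : ℝ × E => (metricDeriv g p.1).inChart x p.2)
    fun y _ t ht => hasDerivWithinAt_inChart_inner hg x y ht
  have hinv : ∀ p ∈ Ici (0 : ℝ) ×ˢ (extChartAt 𝓘(ℝ, E) x).target,
      (FormField.inChart (g p.1).inner x p.2).IsInvertible :=
    fun p hp => inChart_metric_isInvertible (g p.1) x hp.2
  refine ((contDiffOn_inverse hG hinv).clm_comp hV).congr fun p hp => ?_
  rw [inChart_eq_comp_sharp (g p.1) (metricDeriv g p.1) x hp.2]
  ext1 u
  obtain ⟨e, he⟩ := hinv p hp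
  simp [← he]

lemma SolvesODE.contDiffOn_inChart (hg : FormField.IsSmoothFamily (fun t => (g t).inner))
    (hJ : SolvesODE J g) (h0 : (J 0).IsSmooth) (x : X) :
    ContDiffOn ℝ ∞ (fun p : ℝ × E => (J p.1).inChart x p.2)
      (Ici 0 ×ˢ (extChartAt 𝓘(ℝ, E) x).target) := by
  have := FiniteDimensional.complete ℝ E
  rintro ⟨t, y⟩ ⟨ht, hy⟩
  -- Smooth dependence on parameters was proved over convex sets, whereas the chart target need not
  -- be convex; a ball around y suffices, smoothness being local.
  obtain ⟨r, hr, hB⟩ := Metric.isOpen_iff.1 (isOpen_extChartAt_target (I := 𝓘(ℝ, E)) x) y hy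
  have h := contDiffOn_of_bilinear_ode (halfBracket E) Metric.isOpen_ball (convex_ball y r)
    ((contDiffOn_inChart_sharp hg x).mono (prod_mono_right hB))
    (w := fun p : ℝ × E => (J p.1).inChart x p.2)
    (fun z hz s hs => hJ.inChart x (hB hz) hs) ((h0.contDiffOn_inChart x).mono hB)
  refine (h (t, y) ⟨ht, Metric.mem_ball_self hr⟩).mono_of_mem_nhdsWithin ?_
  rw [nhdsWithin_prod_eq]
  exact Filter.prod_mem_prod self_mem_nhdsWithin
    (mem_nhdsWithin_of_mem_nhds (Metric.ball_mem_nhds y hr))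

lemma continuousOn_sharp_metricDeriv (hg : FormField.IsSmoothFamily (fun t => (g t).inner))
    (q : X) : ContinuousOn (Y := E →L[ℝ] E) (fun t => sharp (g t) (metricDeriv g t) q) (Ici 0) := by
  have h1 : ContinuousOn (fun t => (sharp (g t) (metricDeriv g t)).inChart q
      (extChartAt 𝓘(ℝ, E) q q)) (Ici 0) :=
    (contDiffOn_inChart_sharp hg q).continuousOn.comp
      (f := fun t => (t, extChartAt 𝓘(ℝ, E) q q)) (by fun_prop)
      fun s hs => ⟨hs, mem_extChartAt_target q⟩
  have h2 := (conjL (E := E) (frame q (extChartAt 𝓘(ℝ, E) q q))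
    (coframe q (extChartAt 𝓘(ℝ, E) q q))).continuous.comp_continuousOn h1
  simp only [Function.comp_def, EndField.conjL_inChart] at h2
  exact h2

/-! ### Kähler structures along the flow -/

variable (hg : FormField.IsSmoothFamily (fun t => (g t).inner))
  (hF : ∀ t : ℝ, 0 ≤ t → metricDeriv g t ∈ spaceF (g t)) (hJ : SolvesODE J g)
  (h0 : IsKahler (J 0) (g 0))

include hg hJ h0

lemma sq_of_solvesODE {t : ℝ} (ht : 0 ≤ t) (q : X) (ξ : TangentSpace 𝓘(ℝ, E) q) :
    J t q (J t q ξ) = -ξ := by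
  have h := comp_self_eq_neg_one_of_ode (E := E) (J := fun t => J t q)
    (continuousOn_sharp_metricDeriv hg q) (fun s hs => hJ s hs q)
    (ContinuousLinearMap.ext (h0.sq q)) ht
  exact DFunLike.congr_fun h ξ

include hF

lemma invariant_of_solvesODE {t : ℝ} (ht : 0 ≤ t) (q : X) (ξ η : TangentSpace 𝓘(ℝ, E) q) :
    (g t).inner q (J t q ξ) (J t q η) = (g t).inner q ξ η := by
  have hGS : ∀ s : ℝ, (g s).inner q ∘L sharp (g s) (metricDeriv g s) q = metricDeriv g s q :=
    fun s => inner_comp_sharp (g s) _ q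
  have hskew0 : ∀ u w : TangentSpace 𝓘(ℝ, E) q,
      (g 0).inner q (J 0 q u) w + (g 0).inner q u (J 0 q w) = 0 := by
    intro u w
    have h1 := h0.invariant q u (J 0 q w)
    rw [h0.sq q w, map_neg] at h1
    linarith
  -- Skewness is used on the pair ξ, Jη, where J² = -1 converts it into invariance.
  have hskew := skew_of_ode (E := E) (J := fun t => J t q) (G := fun t => (g t).inner q)
    (continuousOn_sharp_metricDeriv hg q) (fun s hs => hJ s hs q)
    (fun s hs => (hasDerivWithinAt_inner hg q hs).congr_deriv (hGS s).symm)
    (fun s hs u w => ?_) (fun u w => ?_) ht ξ (J t q η)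
  · have h1 : (g t).inner q ξ (J t q (J t q η)) = -(g t).inner q ξ η := by
      rw [sq_of_solvesODE hg hJ h0 ht q η, map_neg]
    change (g t).inner q (J t q ξ) (J t q η) + (g t).inner q ξ (J t q (J t q η)) = 0 at hskew
    rw [h1] at hskew
    linarith
  · have h1 := DFunLike.congr_fun (DFunLike.congr_fun (hGS s) u) w
    have h2 := DFunLike.congr_fun (DFunLike.congr_fun (hGS s) w) u
    have h3 := (g s).symm q u (sharp (g s) (metricDeriv g s) q w)
    exact h1.trans (((hF s hs).2.1 q u w).trans (h2.symm.trans h3.symm))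
  · exact hskew0 u w

/-- `covDeriv` at x is computed at the centre of the chart at x, so the whole evolution runs in this
one chart. Closedness is needed only at its centre, and no change of coordinates occurs. -/
lemma parallel_of_solvesODE {t : ℝ} (ht : 0 ≤ t) (x : X) (ξ η : TangentSpace 𝓘(ℝ, E) x) :
    covDeriv (g t) (J t) x ξ η = 0 := by
  have := FiniteDimensional.complete ℝ E
  have h := chartCovDeriv_eq_zero_of_ode (E := E) (U := (extChartAt 𝓘(ℝ, E) x).target)
    (G := fun p => FormField.inChart (g p.1).inner x p.2)
    (V := fun p => (metricDeriv g p.1).inChart x p.2)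
    (S := fun p => (sharp (g p.1) (metricDeriv g p.1)).inChart x p.2)
    (a := fun p => (J p.1).inChart x p.2) (y := extChartAt 𝓘(ℝ, E) x x)
    (isOpen_extChartAt_target x) (hg.contDiffOn_inChart x)
    (fun p _ => FormField.inChart_symm (g p.1).symm x p.2)
    (fun p hp => inChart_metric_isInvertible (g p.1) x hp.2)
    (fun y _ s hs => hasDerivWithinAt_inChart_inner hg x y hs)
    (fun p hp => FormField.inChart_symm (hF p.1 hp.1).2.1 x p.2)
    (contDiffOn_inChart_sharp hg x)
    (fun p hp => inChart_eq_comp_sharp (g p.1) _ x hp.2)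
    (hJ.contDiffOn_inChart hg h0.smooth x)
    (fun y hy s hs => hJ.inChart x hy hs) (mem_extChartAt_target x)
    (fun s hs u w => sub_eq_zero.1 ((hF s hs).2.2 x u w)) ξ
    (ContinuousLinearMap.ext (h0.parallel x ξ)) ht
  exact DFunLike.congr_fun h η

end KahlerVariation

end

theorem mainTheorem5 {E : Type*} [NormedAddCommGroup E] [NormedSpace ℝ E] [FiniteDimensional ℝ E]
    {X : Type*} [TopologicalSpace X] [T2Space X] [SigmaCompactSpace X] [ChartedSpace E X]
    [IsManifold 𝓘(ℝ, E) ∞ X]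
    (g : ℝ → KahlerVariation.Metric E X) (J : ℝ → KahlerVariation.EndField E X)
    (hg : KahlerVariation.FormField.IsSmoothFamily (fun t => (g t).inner))
    (hF : ∀ t : ℝ, 0 ≤ t → KahlerVariation.metricDeriv g t ∈ KahlerVariation.spaceF (g t))
    (hJ : KahlerVariation.SolvesODE J g)
    (h0 : KahlerVariation.IsKahler (J 0) (g 0)) :
    KahlerVariation.EndField.IsSmoothFamily J ∧
      ∀ t : ℝ, 0 ≤ t → KahlerVariation.IsKahler (J t) (g t) := by
  have hs : KahlerVariation.EndField.IsSmoothFamily J :=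
    KahlerVariation.EndField.isSmoothFamily_of_inChart fun x =>
      hJ.contDiffOn_inChart hg h0.smooth x
  exact ⟨hs, fun t ht => ⟨hs.isSmooth ht,
    KahlerVariation.sq_of_solvesODE hg hJ h0 ht,
    KahlerVariation.invariant_of_solvesODE hg hF hJ h0 ht,
    KahlerVariation.parallel_of_solvesODE hg hF hJ h0 ht⟩⟩
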